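/- Let $p,k\in\mathbb N_0$, let $\Omega=\prod_{i=1}^p[a_i,b_i]\subset\mathbb R^p$ (with $a_i<b_i$) be a rectangle equipped with a rectangular grid, i.e. for each $i$ there are nodes $a_i=x_{i,0}<x_{i,1}<\dots<x_{i,M_i}=b_i$ with $M_i\ge 1$, and the grid cells are the closed boxes $Q=\prod_i[x_{i,m_i},x_{i,m_i+1}]$. Fix $N\in\mathbb N\cup\{\infty\}$ with $N\ge p(k+1)$, and let $V$ be the real vector space of functions $\phi:\Omega\to\mathbb R$ that are $C^N$ on each closed grid cell and whose derivatives $\partial^{\vec\alpha}\phi$, $\vec\alpha\in\{0,\dots,k\}^p$, have no jumps: at a point common to two cells, the values computed from the two cells agree. (In particular $V$ contains all functions that are $C^N$ on $\Omega$.) For $\phi\in V$, the Hermite interpolant $\mathcal H_\phi:\Omega\to\mathbb R$ is the function that on each grid cell is a polynomial of degree at most $2k+1$ in each variable and satisfies $\partial^{\vec\alpha}\mathcal H_\phi=\partial^{\vec\alpha}\phi$ at all vertices of the cell for all $\vec\alpha\in\{0,\dots,k\}^p$ (derivatives of $\mathcal H_\phi$ being those of the polynomial of that cell). Let $\vec\beta=(k+1,\dots,k+1)$,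 let $$\mathcal F[\phi]=\int_\Omega\big(\partial^{\vec\beta}\phi(\vec x)\big)^2\,d\vec x$$ be the stability functional, and let $$B(f,g)=\int_\Omega \partial^{\vec\beta}f(\vec x)\,\partial^{\vec\beta}g(\vec x)\,d\vec x ,\qquad f,g\in V,$$ where the derivatives $\partial^{\vec\beta}$ exist in the interior of each cell, hence almost everywhere. Then the integrand in $B(f,g)$ is integrable, and $B$ is a symmetric positive semi-definite bilinear form on $V$ with $B(f,f)=\mathcal F[f]$. For every $\phi\in V$ the interpolant $\mathcal H_\phi$ exists, is unique and belongs to $V$, and the map $P:V\to V$, $\phi\mapsto\mathcal H_\phi$, is an orthogonal projection with respect to $B$: it is linear, $P^2=P$, and $B(u,v)=0$ for all $u$ in the range and all $v$ in the kernel of $P$. The orthogonality holds on every grid cell $Q$ separately: for all $f,g\in V$, $$\int_Q \partial^{\vec\beta}\mathcal H_f\;\partial^{\vec\beta}(g-\mathcal H_g)\,d\vec x=0 .$$ -/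

import Mathlib

open MeasureTheory

noncomputable section

namespace HermiteProj

/-! ### Partial derivatives -/

/-- The first order partial derivative `∂ᵢ f` in the set `s`. It is one-sided at those points of
the boundary of `s` where the line parallel to the `i`-th axis meets `s` on one side only. -/
def partialWithin {p : ℕ} (s : Set (Fin p → ℝ)) (i : Fin p) (f : (Fin p → ℝ) → ℝ) :
    (Fin p → ℝ) → ℝ :=
  fun x => lineDerivWithin ℝ f s x (Pi.single i 1)

/-- The mixed partial derivative `∂^α f = ∂₁^{α₁} ⋯ ∂ₚ^{αₚ} f` in the set `s`. -/
def mixedDeriv {p : ℕ} (s : Set (Fin p → ℝ)) (α : Fin p → ℕ) (f : (Fin p → ℝ) → ℝ) :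
    (Fin p → ℝ) → ℝ :=
  (List.finRange p).foldr (fun i g => (partialWithin s i)^[α i] g) f

/-- The extension by zero of a function on `s`. -/
def zeroExt {p : ℕ} {s : Set (Fin p → ℝ)} (f : s → ℝ) : (Fin p → ℝ) → ℝ :=
  Function.extend Subtype.val f 0

/-! ### Rectangular grids -/

/-- A rectangular (tensor product) grid in `ℝᵖ`: in the `i`-th direction it has `size i ≥ 1`
intervals, bounded by the nodes `node i 0 < node i 1 < ⋯ < node i (size i)`. -/
structure Grid (p : ℕ) where
  size : Fin p → ℕ
  size_pos : ∀ i, 0 < size i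
  node : (i : Fin p) → Fin (size i + 1) → ℝ
  node_strictMono : ∀ i, StrictMono (node i)

namespace Grid

variable {p : ℕ} (G : Grid p)

/-- The closed rectangular computational domain `Ω`. -/
def domain : Set (Fin p → ℝ) :=
  Set.Icc (fun i => G.node i 0) (fun i => G.node i (Fin.last (G.size i)))

/-- The closed grid cell with index `c`. -/
def cell (c : (i : Fin p) → Fin (G.size i)) : Set (Fin p → ℝ) :=
  Set.Icc (fun i => G.node i (c i).castSucc) (fun i => G.node i (c i).succ)

/-- The vertex with index `q ∈ {0,1}ᵖ` of the cell with index `c`. -/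
def vertex (c : (i : Fin p) → Fin (G.size i)) (q : Fin p → Fin 2) : Fin p → ℝ :=
  fun i => if q i = 0 then G.node i (c i).castSucc else G.node i (c i).succ

end Grid

/-! ### Auxiliary facts on partial derivatives in boxes -/

section aux

variable {p : ℕ}

lemma hasLineDerivWithinAt_of_contDiffOn {s : Set (Fin p → ℝ)} {n : ℕ}
    {f : (Fin p → ℝ) → ℝ} (hf : ContDiffOn ℝ ((n + 1 : ℕ) : WithTop ℕ∞) f s) {x : Fin p → ℝ}
    (hx : x ∈ s) (v : Fin p → ℝ) :
    HasLineDerivWithinAt ℝ f (fderivWithin ℝ f s x v) s x v :=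
  ((hf.differentiableOn (by simp) x hx).hasFDerivWithinAt).hasLineDerivWithinAt v

lemma uniqueDiffWithinAt_line {a b : Fin p → ℝ} (hab : ∀ i, a i < b i) {x : Fin p → ℝ}
    (hx : x ∈ Set.Icc a b) (i : Fin p) :
    UniqueDiffWithinAt ℝ ((fun t : ℝ => x + t • (Pi.single i 1 : Fin p → ℝ)) ⁻¹' Set.Icc a b)
      0 := by
  have hs : (fun t : ℝ => x + t • (Pi.single i 1 : Fin p → ℝ)) ⁻¹' Set.Icc a b =
      Set.Icc (a i - x i) (b i - x i) := by
    ext t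
    simp only [Set.mem_preimage, Set.mem_Icc, Pi.le_def, Pi.add_apply, Pi.smul_apply,
      smul_eq_mul]
    constructor
    · rintro ⟨h1, h2⟩
      have h1 := h1 i
      have h2 := h2 i
      simp at h1 h2
      constructor <;> linarith
    · rintro ⟨h1, h2⟩
      refine ⟨fun j => ?_, fun j => ?_⟩ <;> by_cases hj : j = i
      · subst hj; simp; linarith
      · simpa [Pi.single_eq_of_ne hj] using hx.1 j
      · subst hj; simp; linarith
      · simpa [Pi.single_eq_of_ne hj] using hx.2 j
  rw [hs]
  have h1 := hx.1 i
  have h2 := hx.2 i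
  have h3 := hab i
  exact uniqueDiffOn_Icc (by linarith) 0 ⟨by linarith, by linarith⟩

lemma partialWithin_eq {a b : Fin p → ℝ} (hab : ∀ i, a i < b i) {n : ℕ}
    {f : (Fin p → ℝ) → ℝ}
    (hf : ContDiffOn ℝ ((n + 1 : ℕ) : WithTop ℕ∞) f (Set.Icc a b)) (i : Fin p) :
    Set.EqOn (partialWithin (Set.Icc a b) i f)
      (fun x => fderivWithin ℝ f (Set.Icc a b) x (Pi.single i 1)) (Set.Icc a b) := fun _ hx =>
  (hasLineDerivWithinAt_of_contDiffOn hf hx _).derivWithin (uniqueDiffWithinAt_line hab hx i)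

lemma uniqueDiffOn_box {a b : Fin p → ℝ} (hab : ∀ i, a i < b i) :
    UniqueDiffOn ℝ (Set.Icc a b) := by
  rw [← Set.pi_univ_Icc]
  exact UniqueDiffOn.univ_pi fun i => uniqueDiffOn_Icc (hab i)

/-- `T` behaves on the box `[a, b]` like a linear differential operator of order `m`. -/
def IsDiffOp (a b : Fin p → ℝ) (m : ℕ)
    (T : Set (Fin p → ℝ) → ((Fin p → ℝ) → ℝ) → ((Fin p → ℝ) → ℝ)) : Prop :=
  (∀ f g : (Fin p → ℝ) → ℝ, Set.EqOn f g (Set.Icc a b) →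
    Set.EqOn (T (Set.Icc a b) f) (T (Set.Icc a b) g) (Set.Icc a b)) ∧
  ∀ (n : ℕ) (f : (Fin p → ℝ) → ℝ),
    ContDiffOn ℝ ((n + m : ℕ) : WithTop ℕ∞) f (Set.Icc a b) →
    ContDiffOn ℝ (n : WithTop ℕ∞) (T (Set.Icc a b) f) (Set.Icc a b) ∧
    (∀ r : ℝ, Set.EqOn (T (Set.Icc a b) (r • f)) (r • T (Set.Icc a b) f) (Set.Icc a b)) ∧
    (∀ g : (Fin p → ℝ) → ℝ, ContDiffOn ℝ ((n + m : ℕ) : WithTop ℕ∞) g (Set.Icc a b) →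
      Set.EqOn (T (Set.Icc a b) (f + g)) (T (Set.Icc a b) f + T (Set.Icc a b) g)
        (Set.Icc a b)) ∧
    (∀ a' b' : Fin p → ℝ, (∀ i, a' i < b' i) → Set.Icc a' b' ⊆ Set.Icc a b →
      Set.EqOn (T (Set.Icc a' b') f) (T (Set.Icc a b) f) (Set.Icc a' b'))

lemma isDiffOp_id (a b : Fin p → ℝ) : IsDiffOp a b 0 (fun _ f => f) :=
  ⟨fun _ _ h => h, fun _ _ hf => ⟨hf, fun _ _ _ => rfl, fun _ _ _ _ => rfl,
    fun _ _ _ _ _ _ => rfl⟩⟩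

lemma isDiffOp_partialWithin {a b : Fin p → ℝ} (hab : ∀ i, a i < b i) (i : Fin p) :
    IsDiffOp a b 1 (fun s f => partialWithin s i f) := by
  refine ⟨fun f g h x hx => lineDerivWithin_congr' h hx, fun n f hf => ⟨?_, ?_, ?_, ?_⟩⟩
  · refine ContDiffOn.congr ?_ (partialWithin_eq hab hf i)
    exact (hf.fderivWithin (uniqueDiffOn_box hab) (by norm_cast)).clm_apply contDiffOn_const
  · intro r x hx
    exact ((hasLineDerivWithinAt_of_contDiffOn hf hx _).const_smul r).derivWithin
      (uniqueDiffWithinAt_line hab hx i) |>.trans (by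
        simp [partialWithin_eq hab hf i hx])
  · intro g hg x hx
    exact (HasDerivWithinAt.add (hasLineDerivWithinAt_of_contDiffOn hf hx _)
      (hasLineDerivWithinAt_of_contDiffOn hg hx _)).derivWithin
      (uniqueDiffWithinAt_line hab hx i) |>.trans (by
        simp [partialWithin_eq hab hf i hx, partialWithin_eq hab hg i hx])
  · intro a' b' hab' hss x hx
    refine (((hasLineDerivWithinAt_of_contDiffOn hf (hss hx) _).mono hss).derivWithin
      (uniqueDiffWithinAt_line hab' hx i)).trans ?_
    exact (partialWithin_eq hab hf i (hss hx)).symm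

lemma IsDiffOp.comp {a b : Fin p → ℝ} {m m' : ℕ}
    {T T' : Set (Fin p → ℝ) → ((Fin p → ℝ) → ℝ) → ((Fin p → ℝ) → ℝ)}
    (hc : ∀ a' b' : Fin p → ℝ, ∀ f g : (Fin p → ℝ) → ℝ, Set.EqOn f g (Set.Icc a' b') →
      Set.EqOn (T (Set.Icc a' b') f) (T (Set.Icc a' b') g) (Set.Icc a' b'))
    (hT : IsDiffOp a b m T) (hT' : IsDiffOp a b m' T') :
    IsDiffOp a b (m' + m) (fun s f => T s (T' s f)) := by
  refine ⟨fun f g h => hT.1 _ _ (hT'.1 _ _ h), fun n f hf => ?_⟩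
  have e : n + (m' + m) = (n + m) + m' := by omega
  rw [e] at hf
  obtain ⟨h1, h2, h3, h4⟩ := hT'.2 _ _ hf
  obtain ⟨k1, k2, k3, k4⟩ := hT.2 _ _ h1
  refine ⟨k1, fun r => (hT.1 _ _ (h2 r)).trans (k2 r), fun g hg => ?_, fun a' b' hab' hss => ?_⟩
  · rw [e] at hg
    exact (hT.1 _ _ (h3 g hg)).trans (k3 _ (hT'.2 _ _ hg).1)
  · exact (hc _ _ _ _ (h4 a' b' hab' hss)).trans (k4 a' b' hab' hss)

lemma partialWithin_iter_congr (s : Set (Fin p → ℝ)) (i : Fin p) (j : ℕ)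
    {f g : (Fin p → ℝ) → ℝ} (h : Set.EqOn f g s) :
    Set.EqOn ((partialWithin s i)^[j] f) ((partialWithin s i)^[j] g) s := by
  induction j generalizing f g with
  | zero => exact h
  | succ j ih => exact ih fun x hx => lineDerivWithin_congr' h hx

lemma isDiffOp_iter {a b : Fin p → ℝ} (hab : ∀ i, a i < b i) (i : Fin p) (j : ℕ) :
    IsDiffOp a b j (fun s f => (partialWithin s i)^[j] f) := by
  induction j with
  | zero => exact isDiffOp_id a b
  | succ j ih =>
    have h := IsDiffOp.comp (fun a' b' f g h => partialWithin_iter_congr _ i j h) ih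
      (isDiffOp_partialWithin hab i)
    rw [add_comm] at h
    exact h

lemma isDiffOp_mixedDeriv {a b : Fin p → ℝ} (hab : ∀ i, a i < b i) (α : Fin p → ℕ) :
    IsDiffOp a b (∑ i, α i) (fun s f => mixedDeriv s α f) := by
  have key : ∀ l : List (Fin p), IsDiffOp a b ((l.map α).sum)
      (fun s f => l.foldr (fun i g => (partialWithin s i)^[α i] g) f) := by
    intro l
    induction l with
    | nil => exact isDiffOp_id a b
    | cons i l ih =>
      have h := IsDiffOp.comp (fun a' b' f g h => partialWithin_iter_congr _ i (α i) h)
        (isDiffOp_iter hab i (α i)) ih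
      rw [add_comm] at h
      exact h
  have := key (List.finRange p)
  rwa [← List.ofFn_eq_map, List.sum_ofFn] at this

lemma zeroExt_add {s : Set (Fin p → ℝ)} (f g : s → ℝ) :
    zeroExt (f + g) = zeroExt f + zeroExt g := by
  funext x
  by_cases hx : ∃ y : s, (y : Fin p → ℝ) = x
  · obtain ⟨y, rfl⟩ := hx
    simp [zeroExt]
  · simp [zeroExt, Function.extend_apply' _ _ _ hx]

lemma zeroExt_smul {s : Set (Fin p → ℝ)} (r : ℝ) (f : s → ℝ) :
    zeroExt (r • f) = r • zeroExt f := by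
  funext x
  by_cases hx : ∃ y : s, (y : Fin p → ℝ) = x
  · obtain ⟨y, rfl⟩ := hx
    simp [zeroExt]
  · simp [zeroExt, Function.extend_apply' _ _ _ hx]

lemma sum_le_of_le {k : ℕ} {α : Fin p → ℕ} (hα : ∀ i, α i ≤ k) {N : ℕ∞}
    (hN : ((p * (k + 1) : ℕ) : ℕ∞) ≤ N) :
    ((0 + ∑ i, α i : ℕ) : WithTop ℕ∞) ≤ (N : WithTop ℕ∞) := by
  have h1 : ∑ i, α i ≤ p * (k + 1) := by
    calc ∑ i, α i ≤ ∑ _i : Fin p, (k + 1) :=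
          Finset.sum_le_sum fun i _ => (hα i).trans (Nat.le_succ k)
      _ = p * (k + 1) := by simp
  have h2 : ((0 + ∑ i, α i : ℕ) : ℕ∞) ≤ N :=
    le_trans (by rw [zero_add]; exact_mod_cast h1) hN
  exact_mod_cast h2

lemma Grid.cell_lt (G : Grid p) (c : (i : Fin p) → Fin (G.size i)) (i : Fin p) :
    G.node i (c i).castSucc < G.node i (c i).succ :=
  G.node_strictMono i (Fin.castSucc_lt_succ)

end aux

/-! ### The function space, the Hermite interpolant and the stability functional -/

variable {p : ℕ}

/-- The space of sufficiently smooth functions `Ω → ℝ`: those which are `C^N`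
(with `N ≥ p (k + 1)`) in each closed grid cell, and whose derivatives `∂^α` with
`α ∈ {0, …, k}ᵖ` have no jumps, that is, take the same value from any two cells at their common
points. It contains the functions that are `C^N` on `Ω` (see `mem_smoothSpace_of_contDiffOn`). -/
def smoothSpace (G : Grid p) (k : ℕ) (N : ℕ∞) (hN : ((p * (k + 1) : ℕ) : ℕ∞) ≤ N) :
    Submodule ℝ (G.domain → ℝ) where
  carrier := {φ | (∀ c, ContDiffOn ℝ N (zeroExt φ) (G.cell c)) ∧
    ∀ α : Fin p → ℕ, (∀ i, α i ≤ k) → ∀ c c', ∀ x ∈ G.cell c ∩ G.cell c',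
      mixedDeriv (G.cell c) α (zeroExt φ) x = mixedDeriv (G.cell c') α (zeroExt φ) x}
  add_mem' := by
    rintro f g ⟨hf, hf'⟩ ⟨hg, hg'⟩
    refine ⟨fun c => by rw [zeroExt_add]; exact (hf c).add (hg c), fun α hα c c' x hx => ?_⟩
    have key : ∀ c, ∀ x ∈ G.cell c, mixedDeriv (G.cell c) α (zeroExt f + zeroExt g) x =
        mixedDeriv (G.cell c) α (zeroExt f) x + mixedDeriv (G.cell c) α (zeroExt g) x :=
      fun c x hx => ((isDiffOp_mixedDeriv (G.cell_lt c) α).2 0 _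
        ((hf c).of_le (sum_le_of_le hα hN))).2.2.1 _ ((hg c).of_le (sum_le_of_le hα hN)) hx
    rw [zeroExt_add, key c x hx.1, key c' x hx.2, hf' α hα c c' x hx, hg' α hα c c' x hx]
  zero_mem' := by
    have h0 : zeroExt (0 : G.domain → ℝ) = 0 := by
      simpa using zeroExt_smul 0 (0 : G.domain → ℝ)
    have key : ∀ (s : Set (Fin p → ℝ)) (α : Fin p → ℕ), mixedDeriv s α 0 = 0 := by
      intro s α
      have h1 : ∀ i, partialWithin s i 0 = 0 := by
        intro i
        funext x
        simp [partialWithin, lineDerivWithin]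
      have h2 : ∀ i (j : ℕ), (partialWithin s i)^[j] 0 = 0 :=
        fun i j => Function.iterate_fixed (h1 i) j
      rw [mixedDeriv]
      induction List.finRange p with
      | nil => rfl
      | cons i l ih => rw [List.foldr_cons, ih, h2]
    refine ⟨fun c => by rw [h0]; exact contDiffOn_const, fun α _ c c' x _ => ?_⟩
    rw [h0, key, key]
  smul_mem' := by
    rintro r f ⟨hf, hf'⟩
    refine ⟨fun c => by rw [zeroExt_smul]; exact (hf c).const_smul r, fun α hα c c' x hx => ?_⟩
    have key : ∀ c, ∀ x ∈ G.cell c, mixedDeriv (G.cell c) α (r • zeroExt f) x =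
        r • mixedDeriv (G.cell c) α (zeroExt f) x :=
      fun c x hx => ((isDiffOp_mixedDeriv (G.cell_lt c) α).2 0 _
        ((hf c).of_le (sum_le_of_le hα hN))).2.1 r hx
    rw [zeroExt_smul, key c x hx.1, key c' x hx.2, hf' α hα c c' x hx]

lemma Grid.cell_subset_domain (G : Grid p) (c : (i : Fin p) → Fin (G.size i)) :
    G.cell c ⊆ G.domain :=
  Set.Icc_subset_Icc (fun i => (G.node_strictMono i).monotone (Fin.zero_le _))
    (fun i => (G.node_strictMono i).monotone (Fin.le_last _))

/-- Functions that are `C^N` on the whole of `Ω` belong to the space. -/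
lemma mem_smoothSpace_of_contDiffOn (G : Grid p) (k : ℕ) (N : ℕ∞)
    (hN : ((p * (k + 1) : ℕ) : ℕ∞) ≤ N) (φ : G.domain → ℝ)
    (hφ : ContDiffOn ℝ N (zeroExt φ) G.domain) : φ ∈ smoothSpace G k N hN := by
  refine ⟨fun c => hφ.mono (G.cell_subset_domain c), fun α hα c c' x hx => ?_⟩
  have hd : ∀ i, G.node i 0 < G.node i (Fin.last (G.size i)) := fun i =>
    G.node_strictMono i (Fin.mk_lt_mk.2 (G.size_pos i))
  have key : ∀ c, ∀ x ∈ G.cell c, mixedDeriv (G.cell c) α (zeroExt φ) x =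
      mixedDeriv G.domain α (zeroExt φ) x := fun c x hx =>
    ((isDiffOp_mixedDeriv hd α).2 0 _ (hφ.of_le (sum_le_of_le hα hN))).2.2.2 _ _
      (G.cell_lt c) (G.cell_subset_domain c) hx
  rw [key c x hx.1, key c' x hx.2]

/-- `H` is the global Hermite interpolant `H_φ`: on each closed grid cell it is given by a
polynomial of degree at most `n = 2 k + 1` in each variable, whose derivatives of order
`α ∈ {0, …, k}ᵖ` at the vertices of the cell equal the data `∂^α φ` there. -/
def IsHermiteInterpolant (G : Grid p) (k : ℕ) (φ H : G.domain → ℝ) : Prop :=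
  ∀ c : (i : Fin p) → Fin (G.size i), ∃ P : MvPolynomial (Fin p) ℝ,
    (∀ i, P.degreeOf i ≤ 2 * k + 1) ∧
    (∀ x : G.domain, (x : Fin p → ℝ) ∈ G.cell c → H x = MvPolynomial.eval (x : Fin p → ℝ) P) ∧
    ∀ (q : Fin p → Fin 2) (α : Fin p → ℕ), (∀ i, α i ≤ k) →
      mixedDeriv Set.univ α (fun x => MvPolynomial.eval x P) (G.vertex c q) =
        mixedDeriv G.domain α (zeroExt φ) (G.vertex c q)

/-- The derivative `∂^β φ` with `β = (k + 1, …, k + 1)`. For `φ` in the space above it exists in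
the interior of each grid cell, hence almost everywhere in `Ω`. -/
def topDeriv (G : Grid p) (k : ℕ) (φ : G.domain → ℝ) : (Fin p → ℝ) → ℝ :=
  mixedDeriv G.domain (fun _ => k + 1) (zeroExt φ)

/-- The stability functional `F[φ] = ∫_Ω (∂^β φ)²`. -/
def stabilityFunctional (G : Grid p) (k : ℕ) (φ : G.domain → ℝ) : ℝ :=
  ∫ x in G.domain, topDeriv G k φ x ^ 2

end HermiteProj

end

/-!
In one variable, a polynomial of degree at most `2k + 1` is determined by its derivatives of orders
`0, …, k` at two points, and tensor products of the corresponding basis polynomials give the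
interpolant on a cell. A basis polynomial and its derivatives of order at most `k` take values at an
endpoint that depend only on the node and not on the interval, so the interpolants of neighbouring
cells have the same derivatives `∂^α`, `α ∈ {0, …, k}ᵖ`, on their common face.

For the orthogonality on a cell, `∂^β H_f` is a sum of products of univariate polynomials of degree
at most `k`. Integrating such a product against `∂^β w`, where `w = g - H_g`, by parts `k + 1` times
in the first variable kills the polynomial in that variable and leaves integrals over the two faces
orthogonal to it. These have the same shape in one dimension less, and the restrictions of
`∂₁ʲ w`, `j ≤ k`, to the faces inherit vanishing Hermite data at the vertices, so an induction on
`p` applies; in dimension zero the integrand is itself a vanishing datum.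
-/

noncomputable section

namespace HermiteProj

/-! ### Univariate Hermite interpolation -/

section univariate

open Polynomial

variable {F ι : Type*} [Field F] [CharZero F] {s : Finset ι} {v : ι → F} {n : ι → ℕ}

lemma eq_zero_of_eval_iterate_derivative_eq_zero (hv : Set.InjOn v s) {u : F[X]}
    (hu : u.degree < (∑ i ∈ s, n i : ℕ))
    (h : ∀ i ∈ s, ∀ j < n i, (derivative^[j] u).eval (v i) = 0) : u = 0 := by
  by_contra h0
  have hdvd : ∀ i ∈ s, (X - C (v i)) ^ n i ∣ u := fun i hi => by
    rcases Nat.eq_zero_or_pos (n i) with hn | hn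
    · simp [hn]
    · refine (le_rootMultiplicity_iff h0).1 (Nat.le_of_pred_lt ?_)
      exact (lt_rootMultiplicity_iff_isRoot_iterate_derivative h0).2
        fun j hj => h i hi j (Nat.lt_of_le_pred hn hj)
  have hcoprime : (s : Set ι).Pairwise
      (Function.onFun IsCoprime fun i => (X - C (v i)) ^ n i) := fun i hi j hj hij =>
    (isCoprime_X_sub_C_of_isUnit_sub (sub_ne_zero.2 (hv.ne hi hj hij)).isUnit).pow
  refine h0 (eq_zero_of_dvd_of_degree_lt (Finset.prod_dvd_of_coprime hcoprime hdvd) ?_)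
  simpa [degree_prod] using hu

lemma eq_of_eval_iterate_derivative_eq (hv : Set.InjOn v s) {u w : F[X]}
    (hu : u.degree < (∑ i ∈ s, n i : ℕ)) (hw : w.degree < (∑ i ∈ s, n i : ℕ))
    (h : ∀ i ∈ s, ∀ j < n i, (derivative^[j] u).eval (v i) = (derivative^[j] w).eval (v i)) :
    u = w :=
  sub_eq_zero.1 <| eq_zero_of_eval_iterate_derivative_eq_zero hv
    ((degree_sub_le u w).trans_lt (max_lt hu hw)) fun i hi j hj => by
      rw [iterate_derivative_sub, eval_sub, h i hi j hj, sub_self]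

lemma exists_eval_iterate_derivative_eq (hv : Set.InjOn v s) (n : ι → ℕ) (d : ι → ℕ → F) :
    ∃ u : F[X], u.degree < (∑ i ∈ s, n i : ℕ) ∧
      ∀ i ∈ s, ∀ j < n i, (derivative^[j] u).eval (v i) = d i j := by
  let L : degreeLT F (∑ i ∈ s, n i) →ₗ[F] ((Σ i : s, Fin (n i)) → F) :=
    LinearMap.pi fun m => (leval (v m.1)).comp (derivative ^ (m.2 : ℕ)) ∘ₗ Submodule.subtype _
  have hL : ∀ u m, L u m = (derivative^[m.2] (u : F[X])).eval (v m.1) := fun u m => by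
    simp [L, Module.End.pow_apply, leval]
  have hinj : Function.Injective L := by
    rw [injective_iff_map_eq_zero]
    rintro ⟨u, hu⟩ h
    refine Subtype.ext (eq_zero_of_eval_iterate_derivative_eq_zero hv (mem_degreeLT.1 hu) ?_)
    intro i hi j hj
    exact (hL ⟨u, hu⟩ ⟨⟨i, hi⟩, ⟨j, hj⟩⟩).symm.trans (congrFun h _)
  have : FiniteDimensional F (degreeLT F (∑ i ∈ s, n i)) :=
    Module.Finite.equiv (degreeLTEquiv F _).symm
  have hrank : Module.finrank F (degreeLT F (∑ i ∈ s, n i)) =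
      Module.finrank F ((Σ i : s, Fin (n i)) → F) := by
    simp [(degreeLTEquiv F _).finrank_eq, Finset.sum_attach s n]
  obtain ⟨u, hu⟩ := (LinearMap.injective_iff_surjective_of_finrank_eq_finrank hrank).1 hinj
    fun m => d m.1 m.2
  exact ⟨u, mem_degreeLT.1 u.2, fun i hi j hj =>
    (hL u ⟨⟨i, hi⟩, ⟨j, hj⟩⟩).symm.trans (congrFun hu _)⟩

section hermiteBasis

lemma degree_lt_add_one_iff {R : Type*} [Semiring R] {u : R[X]} {m : ℕ} :
    u.degree < (m + 1 : ℕ) ↔ u.natDegree ≤ m := by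
  rw [degree_lt_iff_coeff_zero, natDegree_le_iff_coeff_eq_zero]
  rfl

variable {M : ℕ} {x : Fin (M + 1) → ℝ} (hx : StrictMono x) {k : ℕ}

include hx in
lemma eq_of_eval_iterate_derivative_eq_castSucc_succ (c : Fin M) {u w : ℝ[X]}
    (hu : u.natDegree ≤ 2 * k + 1) (hw : w.natDegree ≤ 2 * k + 1)
    (h : ∀ n ∈ ({c.castSucc, c.succ} : Finset (Fin (M + 1))), ∀ j ≤ k,
      (derivative^[j] u).eval (x n) = (derivative^[j] w).eval (x n)) : u = w := by
  have hsum : ∑ _n ∈ ({c.castSucc, c.succ} : Finset (Fin (M + 1))), (k + 1) = 2 * k + 1 + 1 := by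
    rw [Finset.sum_pair Fin.castSucc_lt_succ.ne]
    ring
  refine eq_of_eval_iterate_derivative_eq (n := fun _ => k + 1) hx.injective.injOn
    ?_ ?_ fun n hn j hj => h n hn j (Nat.le_of_lt_succ hj)
  · rwa [hsum, degree_lt_add_one_iff]
  · rwa [hsum, degree_lt_add_one_iff]

include hx in
lemma exists_hermiteBasis (k : ℕ) (c : Fin M) (m : Fin (M + 1) × Fin (k + 1)) :
    ∃ u : ℝ[X], u.natDegree ≤ 2 * k + 1 ∧
      ∀ n ∈ ({c.castSucc, c.succ} : Finset (Fin (M + 1))), ∀ j : Fin (k + 1),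
        (derivative^[j] u).eval (x n) = if m = (n, j) then 1 else 0 := by
  obtain ⟨u, hu, h⟩ := exists_eval_iterate_derivative_eq (s := {c.castSucc, c.succ})
    hx.injective.injOn (fun _ => k + 1) fun n j => if m.1 = n ∧ (m.2 : ℕ) = j then (1 : ℝ) else 0
  refine ⟨u, degree_lt_add_one_iff.1 (hu.trans_eq ?_), fun n hn j => ?_⟩
  · rw [Finset.sum_pair Fin.castSucc_lt_succ.ne]
    congr 1
    ring
  · rw [h n hn j j.2]
    simp only [Prod.ext_iff, Fin.ext_iff]

/-- The polynomial of the Hermite basis on the interval `[x_c, x_{c+1}]` that belongs to the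
derivative of order `m.2` at the node `x_{m.1}`. Indexing by all nodes of the grid rather than by
the two endpoints makes the index set independent of the interval, which is what allows
polynomials of neighbouring intervals to be compared; it vanishes unless `x_{m.1}` is an endpoint
(`hermiteBasis_eq_zero`). -/
def hermiteBasis (k : ℕ) (c : Fin M) (m : Fin (M + 1) × Fin (k + 1)) : ℝ[X] :=
  (exists_hermiteBasis hx k c m).choose

lemma natDegree_hermiteBasis_le (c : Fin M) (m : Fin (M + 1) × Fin (k + 1)) :
    (hermiteBasis hx k c m).natDegree ≤ 2 * k + 1 :=
  (exists_hermiteBasis hx k c m).choose_spec.1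

lemma eval_iterate_derivative_hermiteBasis {c : Fin M} (m : Fin (M + 1) × Fin (k + 1))
    {n : Fin (M + 1)} (hn : n ∈ ({c.castSucc, c.succ} : Finset (Fin (M + 1)))) {j : ℕ}
    (hj : j < k + 1) :
    (derivative^[j] (hermiteBasis hx k c m)).eval (x n) = if m = (n, ⟨j, hj⟩) then 1 else 0 :=
  (exists_hermiteBasis hx k c m).choose_spec.2 n hn ⟨j, hj⟩

lemma hermiteBasis_eq_zero {c : Fin M} {m : Fin (M + 1) × Fin (k + 1)}
    (hm : m.1 ∉ ({c.castSucc, c.succ} : Finset (Fin (M + 1)))) : hermiteBasis hx k c m = 0 := by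
  refine eq_of_eval_iterate_derivative_eq_castSucc_succ hx c (natDegree_hermiteBasis_le hx c m)
    (by simp) fun n hn j hj => ?_
  rw [eval_iterate_derivative_hermiteBasis hx m hn (Nat.lt_succ_of_le hj), if_neg,
    iterate_derivative_zero, eval_zero]
  rintro rfl
  exact hm hn

lemma sum_eval_iterate_derivative_mul_hermiteBasis (c : Fin M) {u : ℝ[X]}
    (hu : u.natDegree ≤ 2 * k + 1) :
    ∑ m : Fin (M + 1) × Fin (k + 1),
      C ((derivative^[m.2] u).eval (x m.1)) * hermiteBasis hx k c m = u := by
  refine eq_of_eval_iterate_derivative_eq_castSucc_succ hx c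
    (natDegree_sum_le_of_forall_le _ _ fun m _ =>
      (natDegree_C_mul_le _ _).trans (natDegree_hermiteBasis_le hx c m)) hu fun n hn j hj => ?_
  simp [iterate_derivative_sum, iterate_derivative_C_mul, eval_finsetSum,
    eval_iterate_derivative_hermiteBasis hx _ hn (Nat.lt_succ_of_le hj)]

lemma eval_iterate_derivative_hermiteBasis_eq_of_mem {c c' : Fin M} {t : ℝ}
    (ht : t ∈ Set.Icc (x c.castSucc) (x c.succ)) (ht' : t ∈ Set.Icc (x c'.castSucc) (x c'.succ))
    (m : Fin (M + 1) × Fin (k + 1)) {j : ℕ} (hj : j ≤ k) :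
    (derivative^[j] (hermiteBasis hx k c m)).eval t =
      (derivative^[j] (hermiteBasis hx k c' m)).eval t := by
  wlog h : c ≤ c' generalizing c c'
  · exact (this ht' ht (le_of_not_ge h)).symm
  rcases h.eq_or_lt with rfl | h
  · rfl
  have hnode : x c.succ = x c'.castSucc :=
    le_antisymm (hx.monotone (Fin.succ_le_castSucc_iff.2 h)) (ht'.1.trans ht.2)
  obtain rfl : t = x c.succ := le_antisymm ht.2 (hnode ▸ ht'.1)
  rw [eval_iterate_derivative_hermiteBasis hx m (by simp) (Nat.lt_succ_of_le hj),
    eval_iterate_derivative_hermiteBasis hx m (by simp [hx.injective hnode])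
      (Nat.lt_succ_of_le hj)]

end hermiteBasis

end univariate

/-! ### Iterated integration by parts -/

section integrationByParts

variable {a b : ℝ} {u v : ℕ → ℝ → ℝ} {n : ℕ}

open Finset intervalIntegral

lemma integral_mul_iterate_deriv_eq (hab : a ≤ b)
    (hu : ∀ j < n, ∀ t ∈ Set.Icc a b, HasDerivWithinAt (u j) (u (j + 1) t) (Set.Icc a b) t)
    (hu' : ContinuousOn (u n) (Set.Icc a b))
    (hv : ∀ j < n, ∀ t ∈ Set.Icc a b, HasDerivWithinAt (v j) (v (j + 1) t) (Set.Icc a b) t)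
    (hv' : ContinuousOn (v n) (Set.Icc a b)) :
    ∫ t in Set.Icc a b, u 0 t * v n t =
      ∑ j ∈ range n, (-1) ^ j * (u j b * v (n - 1 - j) b - u j a * v (n - 1 - j) a) +
        (-1) ^ n * ∫ t in Set.Icc a b, u n t * v 0 t := by
  induction n generalizing u with
  | zero => simp
  | succ n ih =>
    have hu0 : ContinuousOn (u 1) (Set.Icc a b) := by
      rcases Nat.eq_zero_or_pos n with rfl | hn
      · exact hu'
      · exact fun t ht => (hu 1 (Nat.lt_succ_of_le hn) t ht).continuousWithinAt
    have hparts : ∫ t in Set.Icc a b, u 0 t * v (n + 1) t =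
        u 0 b * v n b - u 0 a * v n a - ∫ t in Set.Icc a b, u 1 t * v n t := by
      simp only [integral_Icc_eq_integral_Ioc, ← integral_of_le hab]
      rw [← Set.uIcc_of_le hab] at *
      exact integral_mul_deriv_eq_deriv_mul_of_hasDerivWithinAt
        (hu 0 n.succ_pos) (hv n n.lt_succ_self)
        hu0.intervalIntegrable hv'.intervalIntegrable
    rw [hparts, ih (u := fun j => u (j + 1)) (fun j hj => hu (j + 1) (Nat.succ_lt_succ hj)) hu'
      (fun j hj => hv j (hj.trans n.lt_succ_self))
      (fun t ht => (hv n n.lt_succ_self t ht).continuousWithinAt), sum_range_succ']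
    have hshift : ∀ j, n - 1 - j = n - (j + 1) := fun j => by omega
    simp only [pow_succ, mul_neg_one, neg_mul, sum_neg_distrib, Nat.add_sub_cancel, hshift,
      Nat.sub_zero, pow_zero, one_mul]
    ring

open Polynomial in
lemma integral_eval_mul_iterate_deriv_eq (hab : a ≤ b) {p : ℝ[X]} (hp : p.degree < n)
    (hv : ∀ j < n, ∀ t ∈ Set.Icc a b, HasDerivWithinAt (v j) (v (j + 1) t) (Set.Icc a b) t)
    (hv' : ContinuousOn (v n) (Set.Icc a b)) :
    ∫ t in Set.Icc a b, p.eval t * v n t =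
      ∑ j ∈ range n, (-1) ^ j * ((derivative^[j] p).eval b * v (n - 1 - j) b -
        (derivative^[j] p).eval a * v (n - 1 - j) a) := by
  have h := integral_mul_iterate_deriv_eq (u := fun j t => (derivative^[j] p).eval t) hab
    (fun j _ t _ => by
      rw [Function.iterate_succ_apply']
      exact (Polynomial.hasDerivAt _ _).hasDerivWithinAt)
    (Polynomial.continuousOn _) hv hv'
  simpa [iterate_derivative_eq_zero_of_degree_lt hp] using h

end integrationByParts

/-! ### Iterated partial derivatives along words -/

section iteratedPartial

variable {p : ℕ} {s : Set (Fin p → ℝ)} {a b : Fin p → ℝ} {f g : (Fin p → ℝ) → ℝ}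

/-- The iterated partial derivative `∂_{w₁} ⋯ ∂_{wₙ} f` in the set `s` along the word
`w = w₁ ⋯ wₙ`. Unlike a multi-index, a word allows partial derivatives to be applied one at a time
and in any order. -/
def iteratedPartial (s : Set (Fin p → ℝ)) (w : List (Fin p)) (f : (Fin p → ℝ) → ℝ) :
    (Fin p → ℝ) → ℝ :=
  w.foldr (partialWithin s) f

/-- The nondecreasing word in which each letter `i` occurs `α i` times. -/
def multiIndexWord (α : Fin p → ℕ) : List (Fin p) :=
  (List.finRange p).flatMap fun i => List.replicate (α i) i

lemma iteratedPartial_cons (i : Fin p) (w : List (Fin p)) :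
    iteratedPartial s (i :: w) f = partialWithin s i (iteratedPartial s w f) := rfl

lemma iteratedPartial_append (w w' : List (Fin p)) :
    iteratedPartial s (w ++ w') f = iteratedPartial s w (iteratedPartial s w' f) :=
  List.foldr_append

lemma iteratedPartial_replicate (n : ℕ) (i : Fin p) :
    iteratedPartial s (List.replicate n i) f = (partialWithin s i)^[n] f := by
  induction n with
  | zero => rfl
  | succ n ih =>
    rw [List.replicate_succ, iteratedPartial_cons, ih, Function.iterate_succ_apply']

lemma mixedDeriv_eq_iteratedPartial (s : Set (Fin p → ℝ)) (α : Fin p → ℕ)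
    (f : (Fin p → ℝ) → ℝ) : mixedDeriv s α f = iteratedPartial s (multiIndexWord α) f := by
  rw [mixedDeriv, multiIndexWord]
  induction List.finRange p with
  | nil => rfl
  | cons i l ih =>
    rw [List.foldr_cons, ih, List.flatMap_cons, iteratedPartial_append,
      iteratedPartial_replicate]

lemma length_multiIndexWord (α : Fin p → ℕ) : (multiIndexWord α).length = ∑ i, α i := by
  simp [multiIndexWord, List.length_flatMap, ← List.ofFn_eq_map, List.sum_ofFn]

lemma count_multiIndexWord (α : Fin p → ℕ) (i : Fin p) : (multiIndexWord α).count i = α i := by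
  simp [multiIndexWord, List.count_flatMap, List.count_replicate, Function.comp_def,
    ← List.ofFn_eq_map, List.sum_ofFn]

lemma iteratedPartial_congr (w : List (Fin p)) (h : Set.EqOn f g s) :
    Set.EqOn (iteratedPartial s w f) (iteratedPartial s w g) s := by
  induction w with
  | nil => exact h
  | cons i w ih => exact partialWithin_iter_congr s i 1 ih

lemma contDiffOn_iteratedPartial (hab : ∀ i, a i < b i) (w : List (Fin p)) {n : ℕ}
    (hf : ContDiffOn ℝ ((n + w.length : ℕ) : WithTop ℕ∞) f (Set.Icc a b)) :
    ContDiffOn ℝ (n : WithTop ℕ∞) (iteratedPartial (Set.Icc a b) w f) (Set.Icc a b) := by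
  induction w generalizing n with
  | nil => exact hf
  | cons i w ih =>
    rw [List.length_cons, Nat.add_comm w.length, ← Nat.add_assoc] at hf
    exact ((isDiffOp_partialWithin hab i).2 n _ (ih hf)).1

lemma partialWithin_eqOn_of_isOpen {t U : Set (Fin p → ℝ)} (hU : IsOpen U) (hs : U ⊆ s)
    (ht : U ⊆ t) (i : Fin p) (h : Set.EqOn f g U) :
    Set.EqOn (partialWithin s i f) (partialWithin t i g) U := by
  intro x hx
  have hn := hU.mem_nhds hx
  rw [partialWithin, partialWithin, lineDerivWithin_of_mem_nhds (Filter.mem_of_superset hn hs),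
    lineDerivWithin_of_mem_nhds (Filter.mem_of_superset hn ht)]
  exact (Filter.eventuallyEq_of_mem hn h).lineDeriv_eq

lemma iteratedPartial_eqOn_of_isOpen {t U : Set (Fin p → ℝ)} (hU : IsOpen U) (hs : U ⊆ s)
    (ht : U ⊆ t) (w : List (Fin p)) (h : Set.EqOn f g U) :
    Set.EqOn (iteratedPartial s w f) (iteratedPartial t w g) U := by
  induction w with
  | nil => exact h
  | cons i w ih => exact partialWithin_eqOn_of_isOpen hU hs ht i ih

end iteratedPartial

/-! ### Symmetry of iterated partial derivatives in boxes -/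

section symmetry

variable {p : ℕ} {a b : Fin p → ℝ}

lemma Icc_subset_closure_interior_Icc (hab : ∀ i, a i < b i) :
    Set.Icc a b ⊆ closure (interior (Set.Icc a b)) := by
  rw [← Set.pi_univ_Icc, interior_pi_set Set.finite_univ, closure_pi_set]
  exact Set.pi_mono fun i _ => by rw [interior_Icc, closure_Ioo (hab i).ne]

variable {f : (Fin p → ℝ) → ℝ} (hab : ∀ i, a i < b i)

include hab

lemma partialWithin_partialWithin_eq (i j : Fin p)
    (hf : ContDiffOn ℝ ((1 + 1 : ℕ) : WithTop ℕ∞) f (Set.Icc a b)) :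
    Set.EqOn (partialWithin (Set.Icc a b) i (partialWithin (Set.Icc a b) j f))
      (fun x => fderivWithin ℝ (fderivWithin ℝ f (Set.Icc a b)) (Set.Icc a b) x
        (Pi.single i 1) (Pi.single j 1)) (Set.Icc a b) := by
  have hu := uniqueDiffOn_box hab
  have hf' : ContDiffOn ℝ ((0 + 1 : ℕ) : WithTop ℕ∞) (fderivWithin ℝ f (Set.Icc a b))
      (Set.Icc a b) := hf.fderivWithin hu (by norm_cast)
  intro x hx
  have hinner := partialWithin_iter_congr _ i 1 (partialWithin_eq hab hf j) hx
  have houter := partialWithin_eq hab (hf'.clm_apply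
    (contDiffOn_const (c := (Pi.single j 1 : Fin p → ℝ)))) i hx
  have happly := ((hf'.differentiableOn (by simp) x hx).hasFDerivWithinAt).clm_apply
    (hasFDerivWithinAt_const (Pi.single j 1 : Fin p → ℝ) x (Set.Icc a b))
  exact (hinner.trans houter).trans
    ((DFunLike.congr_fun (happly.fderivWithin (hu x hx)) _).trans (by simp))

lemma partialWithin_comm (i j : Fin p)
    (hf : ContDiffOn ℝ ((1 + 1 : ℕ) : WithTop ℕ∞) f (Set.Icc a b)) :
    Set.EqOn (partialWithin (Set.Icc a b) i (partialWithin (Set.Icc a b) j f))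
      (partialWithin (Set.Icc a b) j (partialWithin (Set.Icc a b) i f)) (Set.Icc a b) := by
  intro x hx
  rw [partialWithin_partialWithin_eq hab i j hf hx, partialWithin_partialWithin_eq hab j i hf hx]
  exact (hf x hx).isSymmSndFDerivWithinAt (by simp) (uniqueDiffOn_box hab)
    (Icc_subset_closure_interior_Icc hab hx) hx _ _

lemma iteratedPartial_eqOn_of_perm {w w' : List (Fin p)} (hw : w.Perm w')
    (hf : ContDiffOn ℝ (w.length : WithTop ℕ∞) f (Set.Icc a b)) :
    Set.EqOn (iteratedPartial (Set.Icc a b) w f) (iteratedPartial (Set.Icc a b) w' f)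
      (Set.Icc a b) := by
  induction hw with
  | nil => exact fun _ _ => rfl
  | cons i _ ih =>
    exact iteratedPartial_congr [i] (ih (hf.of_le (by exact_mod_cast Nat.le_succ _)))
  | swap i j w =>
    refine partialWithin_comm hab j i (contDiffOn_iteratedPartial hab w (hf.of_le ?_))
    exact_mod_cast (by simp only [List.length_cons]; omega)
  | trans hw _ ih ih' => exact (ih hf).trans (ih' (by rwa [← hw.length_eq]))

lemma iteratedPartial_eqOn_mixedDeriv_count (w : List (Fin p))
    (hf : ContDiffOn ℝ (w.length : WithTop ℕ∞) f (Set.Icc a b)) :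
    Set.EqOn (iteratedPartial (Set.Icc a b) w f) (mixedDeriv (Set.Icc a b) (w.count ·) f)
      (Set.Icc a b) := by
  rw [mixedDeriv_eq_iteratedPartial]
  exact iteratedPartial_eqOn_of_perm hab
    (List.perm_iff_count.2 fun i => (count_multiIndexWord (w.count ·) i).symm) hf

end symmetry

/-! ### Sums of products of univariate polynomials -/

section tensorSum

open Polynomial

variable {p : ℕ} {ι : Type*}

/-- The function `x ↦ ∑ₘ wₘ ∏ᵢ uₘᵢ(xᵢ)`. Polynomials and tensor product interpolants both have this
form, and their partial derivatives act on the univariate factors. -/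
def tensorSum (S : Finset ι) (w : ι → ℝ) (u : ι → Fin p → ℝ[X]) (x : Fin p → ℝ) : ℝ :=
  ∑ m ∈ S, w m * ∏ i, (u m i).eval (x i)

/-- The set `s` determines the partial derivatives at its points. This holds for boxes and for the
whole space, the two kinds of sets in which polynomials are differentiated. -/
def UniqueLineDiffOn (s : Set (Fin p → ℝ)) : Prop :=
  ∀ x ∈ s, ∀ i, UniqueDiffWithinAt ℝ
    ((fun t : ℝ => x + t • (Pi.single i 1 : Fin p → ℝ)) ⁻¹' s) 0

lemma uniqueLineDiffOn_Icc {a b : Fin p → ℝ} (hab : ∀ i, a i < b i) :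
    UniqueLineDiffOn (Set.Icc a b) := fun _ hx i => uniqueDiffWithinAt_line hab hx i

lemma uniqueLineDiffOn_univ : UniqueLineDiffOn (Set.univ : Set (Fin p → ℝ)) := fun _ _ _ => by
  rw [Set.preimage_univ]
  exact uniqueDiffWithinAt_univ

lemma hasDerivAt_prod_eval_add_single (u : Fin p → ℝ[X]) (x : Fin p → ℝ) (i : Fin p) :
    HasDerivAt (fun t : ℝ => ∏ j, (u j).eval ((x + t • (Pi.single i 1 : Fin p → ℝ)) j))
      (∏ j, (Function.update u i (derivative (u i)) j).eval (x j)) 0 := by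
  have hline : ∀ t : ℝ, ∏ j, (u j).eval ((x + t • (Pi.single i 1 : Fin p → ℝ)) j) =
      (u i).eval (x i + t) * ∏ j ∈ Finset.univ.erase i, (u j).eval (x j) := fun t => by
    rw [← Finset.mul_prod_erase _ _ (Finset.mem_univ i)]
    congr 1
    · simp
    · exact Finset.prod_congr rfl fun j hj => by
        simp [Pi.single_eq_of_ne (Finset.ne_of_mem_erase hj)]
  have hderiv : ∏ j, (Function.update u i (derivative (u i)) j).eval (x j) =
      (derivative (u i)).eval (x i) * ∏ j ∈ Finset.univ.erase i, (u j).eval (x j) := by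
    rw [← Finset.mul_prod_erase _ _ (Finset.mem_univ i), Function.update_self]
    exact congrArg _ (Finset.prod_congr rfl fun j hj => by
      rw [Function.update_of_ne (Finset.ne_of_mem_erase hj)])
  simp only [hline, hderiv]
  refine HasDerivAt.mul_const ?_ _
  simpa using HasDerivAt.comp_const_add (x i) 0 ((u i).hasDerivAt (x i + 0))

variable {s : Set (Fin p → ℝ)} (hs : UniqueLineDiffOn s) (S : Finset ι) (w : ι → ℝ)
  (u : ι → Fin p → ℝ[X])

include hs in
lemma partialWithin_tensorSum (i : Fin p) : Set.EqOn (partialWithin s i (tensorSum S w u))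
    (tensorSum S w fun m => Function.update (u m) i (derivative (u m i))) s := fun x hx =>
  (HasDerivAt.fun_sum fun m _ =>
    (hasDerivAt_prod_eval_add_single (u m) x i).const_mul (w m)).hasDerivWithinAt.derivWithin
      (hs x hx i)

include hs in
lemma iteratedPartial_tensorSum (l : List (Fin p)) :
    Set.EqOn (iteratedPartial s l (tensorSum S w u))
      (tensorSum S w fun m j => derivative^[l.count j] (u m j)) s := by
  induction l with
  | nil => exact fun _ _ => rfl
  | cons i l ih =>
    refine (iteratedPartial_congr [i] ih).trans
      ((partialWithin_tensorSum hs S w _ i).trans fun x _ => ?_)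
    congr 1
    funext m j
    rcases eq_or_ne j i with rfl | hj
    · rw [Function.update_self, List.count_cons_self, Function.iterate_succ_apply']
    · rw [Function.update_of_ne hj, List.count_cons_of_ne hj.symm]

include hs in
lemma mixedDeriv_tensorSum (α : Fin p → ℕ) : Set.EqOn (mixedDeriv s α (tensorSum S w u))
    (tensorSum S w fun m j => derivative^[α j] (u m j)) s := by
  simpa only [mixedDeriv_eq_iteratedPartial, count_multiIndexWord] using
    iteratedPartial_tensorSum hs S w u (multiIndexWord α)

lemma contDiff_tensorSum {n : WithTop ℕ∞} : ContDiff ℝ n (tensorSum S w u) := by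
  refine ContDiff.sum fun m _ => contDiff_const.mul (contDiff_prod fun i _ => ?_)
  have h : ContDiff ℝ n fun t => (u m i).eval t := by
    simpa using (u m i).contDiff_aeval (R := ℝ) (𝕜 := ℝ) n
  exact h.comp (contDiff_apply ℝ ℝ i)

lemma eval_eq_tensorSum (P : MvPolynomial (Fin p) ℝ) :
    (fun x => MvPolynomial.eval x P) =
      tensorSum P.support (fun m => P.coeff m) fun m i => X ^ m i := by
  funext x
  simp [tensorSum, MvPolynomial.eval_eq']

lemma degreeOf_toMvPolynomial_le {R σ : Type*} [CommSemiring R] [Nontrivial R] [DecidableEq σ]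
    (i j : σ) (q : R[X]) : (q.toMvPolynomial j).degreeOf i ≤ if i = j then q.natDegree else 0 := by
  rw [toMvPolynomial, aeval_eq_sum_range]
  refine (MvPolynomial.degreeOf_sum_le i _ _).trans (Finset.sup_le fun d hd => ?_)
  rw [MvPolynomial.smul_eq_C_mul]
  refine (MvPolynomial.degreeOf_C_mul_le _ i _).trans
    ((MvPolynomial.degreeOf_pow_le i _ _).trans ?_)
  rw [MvPolynomial.degreeOf_X]
  split_ifs
  · simpa using Finset.mem_range_succ_iff.1 hd
  · simp

variable {u} in
lemma exists_mvPolynomial_eval_eq_tensorSum {n : ℕ} (hu : ∀ m i, (u m i).natDegree ≤ n) :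
    ∃ P : MvPolynomial (Fin p) ℝ, (∀ i, P.degreeOf i ≤ n) ∧
      ∀ x, MvPolynomial.eval x P = tensorSum S w u x := by
  refine ⟨∑ m ∈ S, MvPolynomial.C (w m) * ∏ i, (u m i).toMvPolynomial i, fun i => ?_,
    fun x => by simp [tensorSum]⟩
  refine (MvPolynomial.degreeOf_sum_le i _ _).trans (Finset.sup_le fun m _ => ?_)
  calc _ ≤ (∏ j, (u m j).toMvPolynomial j).degreeOf i := MvPolynomial.degreeOf_C_mul_le _ _ _
    _ ≤ ∑ j, ((u m j).toMvPolynomial j).degreeOf i := MvPolynomial.degreeOf_prod_le i _ _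
    _ ≤ ∑ j, if i = j then (u m j).natDegree else 0 :=
      Finset.sum_le_sum fun j _ => degreeOf_toMvPolynomial_le i j _
    _ ≤ n := by simpa using hu m i

end tensorSum

/-! ### Splitting off the first variable -/

section slice

variable {p : ℕ} {a b : Fin (p + 1) → ℝ} {f : (Fin (p + 1) → ℝ) → ℝ}

lemma cons_mem_Icc {t : ℝ} {y : Fin p → ℝ} :
    (Fin.cons t y : Fin (p + 1) → ℝ) ∈ Set.Icc a b ↔
      t ∈ Set.Icc (a 0) (b 0) ∧ y ∈ Set.Icc (Fin.tail a) (Fin.tail b) := by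
  simp only [Set.mem_Icc, Pi.le_def, Fin.forall_fin_succ, Fin.cons_zero, Fin.cons_succ, Fin.tail]
  tauto

lemma contDiff_cons_right (n : WithTop ℕ∞) (t : ℝ) :
    ContDiff ℝ n (fun y : Fin p → ℝ => (Fin.cons t y : Fin (p + 1) → ℝ)) :=
  contDiff_pi.2 <| Fin.cases (by simpa using contDiff_const) fun j => by
    simpa using contDiff_apply ℝ ℝ j

lemma hasDerivAt_cons_left (y : Fin p → ℝ) (t : ℝ) :
    HasDerivAt (fun t : ℝ => (Fin.cons t y : Fin (p + 1) → ℝ)) (Pi.single 0 1) t :=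
  hasDerivAt_pi.2 <| Fin.cases (by simpa using hasDerivAt_id' t) fun j => by
    simpa using hasDerivAt_const t (y j)

lemma hasDerivWithinAt_cons (hab : ∀ i, a i < b i) {n : ℕ}
    (hf : ContDiffOn ℝ ((n + 1 : ℕ) : WithTop ℕ∞) f (Set.Icc a b)) {y : Fin p → ℝ}
    (hy : y ∈ Set.Icc (Fin.tail a) (Fin.tail b)) {t : ℝ} (ht : t ∈ Set.Icc (a 0) (b 0)) :
    HasDerivWithinAt (fun t : ℝ => f (Fin.cons t y))
      (partialWithin (Set.Icc a b) 0 f (Fin.cons t y)) (Set.Icc (a 0) (b 0)) t := by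
  have hx : (Fin.cons t y : Fin (p + 1) → ℝ) ∈ Set.Icc a b := cons_mem_Icc.2 ⟨ht, hy⟩
  rw [partialWithin_eq hab hf 0 hx]
  exact ((hf.differentiableOn (by simp) _ hx).hasFDerivWithinAt).comp_hasDerivWithinAt t
    (hasDerivAt_cons_left y t).hasDerivWithinAt fun s hs => cons_mem_Icc.2 ⟨hs, hy⟩

lemma partialWithin_succ_cons {t : ℝ} (ht : t ∈ Set.Icc (a 0) (b 0)) (i : Fin p)
    (f : (Fin (p + 1) → ℝ) → ℝ) :
    (fun y : Fin p → ℝ => partialWithin (Set.Icc a b) i.succ f (Fin.cons t y)) =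
      partialWithin (Set.Icc (Fin.tail a) (Fin.tail b)) i fun y => f (Fin.cons t y) := by
  funext y
  have hline : ∀ r : ℝ, (Fin.cons t y : Fin (p + 1) → ℝ) +
      r • (Pi.single i.succ 1 : Fin (p + 1) → ℝ) =
        Fin.cons t (y + r • (Pi.single i 1 : Fin p → ℝ)) := fun r =>
    funext <| Fin.cases (by simp) fun j => by simp [Pi.single_apply]
  simp only [partialWithin, lineDerivWithin, hline, Set.preimage, cons_mem_Icc, ht, true_and]

lemma iteratedPartial_map_succ_cons {t : ℝ} (ht : t ∈ Set.Icc (a 0) (b 0)) (w : List (Fin p))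
    (f : (Fin (p + 1) → ℝ) → ℝ) :
    (fun y : Fin p → ℝ => iteratedPartial (Set.Icc a b) (w.map Fin.succ) f (Fin.cons t y)) =
      iteratedPartial (Set.Icc (Fin.tail a) (Fin.tail b)) w fun y => f (Fin.cons t y) := by
  induction w with
  | nil => rfl
  | cons i w ih =>
    simp only [List.map_cons, iteratedPartial_cons, partialWithin_succ_cons ht, ih]

lemma multiIndexWord_cons (j : ℕ) (α : Fin p → ℕ) :
    multiIndexWord (Fin.cons j α : Fin (p + 1) → ℕ) =
      List.replicate j 0 ++ (multiIndexWord α).map Fin.succ := by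
  simp [multiIndexWord, List.finRange_succ, List.flatMap_map, List.map_flatMap]

lemma mixedDeriv_cons_succ (s : Set (Fin (p + 1) → ℝ)) (j : ℕ) (α : Fin p → ℕ) :
    mixedDeriv s (Fin.cons (j + 1) α) f = partialWithin s 0 (mixedDeriv s (Fin.cons j α) f) := by
  simp only [mixedDeriv_eq_iteratedPartial, multiIndexWord_cons, List.replicate_succ,
    List.cons_append, iteratedPartial_cons]

lemma mixedDeriv_cons_apply_cons (hab : ∀ i, a i < b i) {j : ℕ} {α : Fin p → ℕ}
    (hf : ContDiffOn ℝ ((j + ∑ i, α i : ℕ) : WithTop ℕ∞) f (Set.Icc a b)) {t : ℝ}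
    (ht : t ∈ Set.Icc (a 0) (b 0)) {y : Fin p → ℝ}
    (hy : y ∈ Set.Icc (Fin.tail a) (Fin.tail b)) :
    mixedDeriv (Set.Icc a b) (Fin.cons j α) f (Fin.cons t y) =
      mixedDeriv (Set.Icc (Fin.tail a) (Fin.tail b)) α
        (fun y => (partialWithin (Set.Icc a b) 0)^[j] f (Fin.cons t y)) y := by
  rw [mixedDeriv_eq_iteratedPartial, mixedDeriv_eq_iteratedPartial, multiIndexWord_cons,
    iteratedPartial_eqOn_of_perm hab List.perm_append_comm (by
      rwa [List.length_append, List.length_replicate, List.length_map, length_multiIndexWord])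
      (cons_mem_Icc.2 ⟨ht, hy⟩), iteratedPartial_append, iteratedPartial_replicate]
  exact congrFun (iteratedPartial_map_succ_cons ht _ _) y

lemma contDiffOn_iterate_partialWithin_cons (hab : ∀ i, a i < b i) {n j : ℕ}
    (hf : ContDiffOn ℝ ((n + j : ℕ) : WithTop ℕ∞) f (Set.Icc a b)) {t : ℝ}
    (ht : t ∈ Set.Icc (a 0) (b 0)) :
    ContDiffOn ℝ (n : WithTop ℕ∞)
      (fun y : Fin p → ℝ => (partialWithin (Set.Icc a b) 0)^[j] f (Fin.cons t y))
      (Set.Icc (Fin.tail a) (Fin.tail b)) :=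
  ((isDiffOp_iter hab 0 j).2 n f hf).1.comp (contDiff_cons_right _ t).contDiffOn
    fun _ hy => cons_mem_Icc.2 ⟨ht, hy⟩

lemma setIntegral_Icc_eq_setIntegral_cons {E : Type*} [NormedAddCommGroup E] [NormedSpace ℝ E]
    {g : (Fin (p + 1) → ℝ) → E} (hg : ContinuousOn g (Set.Icc a b)) :
    ∫ x in Set.Icc a b, g x = ∫ y in Set.Icc (Fin.tail a) (Fin.tail b),
      ∫ t in Set.Icc (a 0) (b 0), g (Fin.cons t y) := by
  let e := (MeasurableEquiv.piFinSuccAbove (fun _ : Fin (p + 1) => ℝ) 0).symm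
  have he : MeasurePreserving e :=
    (volume_preserving_piFinSuccAbove (fun _ : Fin (p + 1) => ℝ) 0).symm
  have hcons : ∀ z : ℝ × (Fin p → ℝ), e z = Fin.cons z.1 z.2 := fun z => by
    rw [← Fin.insertNth_zero']
    rfl
  have hpre : e ⁻¹' Set.Icc a b =
      Set.Icc (a 0) (b 0) ×ˢ Set.Icc (Fin.tail a) (Fin.tail b) := by
    ext z
    rw [Set.mem_preimage, hcons, cons_mem_Icc, Set.mem_prod]
  have hint := hg.integrableOn_compact (μ := volume) isCompact_Icc
  rw [← he.integrableOn_comp_preimage e.measurableEmbedding, hpre, IntegrableOn,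
    Measure.volume_eq_prod, ← Measure.prod_restrict] at hint
  rw [← he.setIntegral_preimage_emb e.measurableEmbedding, hpre, Measure.volume_eq_prod,
    ← Measure.prod_restrict]
  refine (integral_prod_symm _ hint).trans ?_
  simp only [Function.comp_apply, hcons]

end slice

/-! ### Orthogonality of low degree polynomials to the top derivative -/

section orthogonality

open Polynomial

/-- All derivatives `∂^α f` of orders `α < β` (strictly in each coordinate) vanish at the vertices
of the box `[a, b]`. For `β = (k + 1, …, k + 1)` this says that the Hermite data of order `k` of
`f` on the box are zero. -/
def VanishesAtVertices {p : ℕ} (a b : Fin p → ℝ) (β : Fin p → ℕ) (f : (Fin p → ℝ) → ℝ) : Prop :=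
  ∀ v : Fin p → ℝ, (∀ i, v i ∈ ({a i, b i} : Set ℝ)) → ∀ α : Fin p → ℕ, (∀ i, α i < β i) →
    mixedDeriv (Set.Icc a b) α f v = 0

lemma mem_Icc_of_mem_endpoints {α : Type*} [Preorder α] {a b t : α} (hab : a ≤ b)
    (ht : t ∈ ({a, b} : Set α)) : t ∈ Set.Icc a b := by
  rcases ht with rfl | rfl
  exacts [Set.left_mem_Icc.2 hab, Set.right_mem_Icc.2 hab]

lemma contDiffOn_mixedDeriv {p : ℕ} {a b : Fin p → ℝ} (hab : ∀ i, a i < b i) {n m : ℕ}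
    {α : Fin p → ℕ} (h : n + ∑ i, α i ≤ m) {f : (Fin p → ℝ) → ℝ}
    (hf : ContDiffOn ℝ (m : WithTop ℕ∞) f (Set.Icc a b)) :
    ContDiffOn ℝ (n : WithTop ℕ∞) (mixedDeriv (Set.Icc a b) α f) (Set.Icc a b) :=
  ((isDiffOp_mixedDeriv hab α).2 n f (hf.of_le (by exact_mod_cast h))).1

variable {p : ℕ} {a b : Fin (p + 1) → ℝ} (hab : ∀ i, a i < b i) {f : (Fin (p + 1) → ℝ) → ℝ}

include hab

lemma VanishesAtVertices.slice {n : ℕ} {α : Fin p → ℕ}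
    (hf : ContDiffOn ℝ ((n + ∑ i, α i : ℕ) : WithTop ℕ∞) f (Set.Icc a b))
    (hv : VanishesAtVertices a b (Fin.cons n α) f) {j : ℕ} (hj : j < n) {t : ℝ}
    (ht : t ∈ ({a 0, b 0} : Set ℝ)) :
    VanishesAtVertices (Fin.tail a) (Fin.tail b) α
      fun y => (partialWithin (Set.Icc a b) 0)^[j] f (Fin.cons t y) := by
  intro v hvmem γ hγ
  have hvIcc : v ∈ Set.Icc (Fin.tail a) (Fin.tail b) :=
    ⟨fun i => (mem_Icc_of_mem_endpoints (hab i.succ).le (hvmem i)).1,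
      fun i => (mem_Icc_of_mem_endpoints (hab i.succ).le (hvmem i)).2⟩
  have hle : j + ∑ i, γ i ≤ n + ∑ i, α i :=
    add_le_add hj.le (Finset.sum_le_sum fun i _ => (hγ i).le)
  rw [← mixedDeriv_cons_apply_cons hab (hf.of_le (by exact_mod_cast hle))
    (mem_Icc_of_mem_endpoints (hab 0).le ht) hvIcc]
  exact hv _ (Fin.cases ht hvmem) _ (Fin.cases hj hγ)

lemma continuousOn_prod_eval_mul_mixedDeriv_cons (u : Fin p → ℝ[X]) {n : ℕ} {α : Fin p → ℕ}
    (hf : ContDiffOn ℝ ((n + ∑ i, α i : ℕ) : WithTop ℕ∞) f (Set.Icc a b)) {j : ℕ} (hj : j ≤ n)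
    {t : ℝ} (ht : t ∈ Set.Icc (a 0) (b 0)) :
    ContinuousOn (fun y : Fin p → ℝ => (∏ i, (u i).eval (y i)) *
      mixedDeriv (Set.Icc a b) (Fin.cons j α) f (Fin.cons t y))
      (Set.Icc (Fin.tail a) (Fin.tail b)) := by
  have hderiv : ContDiffOn ℝ (0 : ℕ) (mixedDeriv (Set.Icc a b) (Fin.cons j α) f) (Set.Icc a b) :=
    contDiffOn_mixedDeriv hab (by rw [Fin.sum_cons]; omega) hf
  refine ContinuousOn.mul (Continuous.continuousOn (by fun_prop)) ?_
  exact hderiv.continuousOn.comp (contDiff_cons_right 0 t).continuous.continuousOn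
    fun y hy => cons_mem_Icc.2 ⟨ht, hy⟩

lemma setIntegral_eval_mul_mixedDeriv_cons {n : ℕ} {u : ℝ[X]} (hu : u.degree < n)
    {α : Fin p → ℕ} (hf : ContDiffOn ℝ ((n + ∑ i, α i : ℕ) : WithTop ℕ∞) f (Set.Icc a b))
    {y : Fin p → ℝ} (hy : y ∈ Set.Icc (Fin.tail a) (Fin.tail b)) :
    ∫ t in Set.Icc (a 0) (b 0), u.eval t *
        mixedDeriv (Set.Icc a b) (Fin.cons n α) f (Fin.cons t y) =
      ∑ j ∈ Finset.range n, (-1) ^ j *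
        ((derivative^[j] u).eval (b 0) *
            mixedDeriv (Set.Icc a b) (Fin.cons (n - 1 - j) α) f (Fin.cons (b 0) y) -
          (derivative^[j] u).eval (a 0) *
            mixedDeriv (Set.Icc a b) (Fin.cons (n - 1 - j) α) f (Fin.cons (a 0) y)) := by
  refine integral_eval_mul_iterate_deriv_eq (hab 0).le hu
    (v := fun j t => mixedDeriv (Set.Icc a b) (Fin.cons j α) f (Fin.cons t y))
    (fun j hj t ht => ?_) ?_
  · rw [mixedDeriv_cons_succ]
    exact hasDerivWithinAt_cons hab (n := 0)
      (contDiffOn_mixedDeriv hab (by rw [Fin.sum_cons]; omega) hf) hy ht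
  · exact (contDiffOn_mixedDeriv hab (n := 0) (by rw [Fin.sum_cons]; omega) hf).continuousOn.comp
      (fun t _ => (hasDerivAt_cons_left y t).continuousAt.continuousWithinAt)
      fun t ht => cons_mem_Icc.2 ⟨ht, hy⟩

lemma setIntegral_prod_eval_mul_mixedDeriv_cons {n : ℕ} {u : Fin (p + 1) → ℝ[X]}
    (hu : (u 0).degree < n) {α : Fin p → ℕ}
    (hf : ContDiffOn ℝ ((n + ∑ i, α i : ℕ) : WithTop ℕ∞) f (Set.Icc a b))
    {y : Fin p → ℝ} (hy : y ∈ Set.Icc (Fin.tail a) (Fin.tail b)) :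
    ∫ t in Set.Icc (a 0) (b 0), (∏ i, (u i).eval ((Fin.cons t y : Fin (p + 1) → ℝ) i)) *
        mixedDeriv (Set.Icc a b) (Fin.cons n α) f (Fin.cons t y) =
      ∑ j ∈ Finset.range n, (-1) ^ j *
        ((derivative^[j] (u 0)).eval (b 0) * ((∏ i, (u i.succ).eval (y i)) *
            mixedDeriv (Set.Icc a b) (Fin.cons (n - 1 - j) α) f (Fin.cons (b 0) y)) -
          (derivative^[j] (u 0)).eval (a 0) * ((∏ i, (u i.succ).eval (y i)) *
            mixedDeriv (Set.Icc a b) (Fin.cons (n - 1 - j) α) f (Fin.cons (a 0) y))) := by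
  have hsplit : ∀ t, (∏ i, (u i).eval ((Fin.cons t y : Fin (p + 1) → ℝ) i)) *
      mixedDeriv (Set.Icc a b) (Fin.cons n α) f (Fin.cons t y) =
        (∏ i, (u i.succ).eval (y i)) * ((u 0).eval t *
          mixedDeriv (Set.Icc a b) (Fin.cons n α) f (Fin.cons t y)) := fun t => by
    rw [Fin.prod_univ_succ]
    simp only [Fin.cons_zero, Fin.cons_succ]
    ring
  simp only [hsplit]
  rw [integral_const_mul, setIntegral_eval_mul_mixedDeriv_cons hab hu hf hy, Finset.mul_sum]
  exact Finset.sum_congr rfl fun j _ => by ring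

lemma setIntegral_prod_eval_mul_mixedDeriv_eq_zero_of_faces {n : ℕ} {u : Fin (p + 1) → ℝ[X]}
    (hu : (u 0).degree < n) {α : Fin p → ℕ}
    (hf : ContDiffOn ℝ ((n + ∑ i, α i : ℕ) : WithTop ℕ∞) f (Set.Icc a b))
    (hface : ∀ j < n, ∀ t ∈ ({a 0, b 0} : Set ℝ),
      ∫ y in Set.Icc (Fin.tail a) (Fin.tail b), (∏ i, (u i.succ).eval (y i)) *
        mixedDeriv (Set.Icc a b) (Fin.cons j α) f (Fin.cons t y) = 0) :
    ∫ x in Set.Icc a b, (∏ i, (u i).eval (x i)) *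
      mixedDeriv (Set.Icc a b) (Fin.cons n α) f x = 0 := by
  have hcont : ContinuousOn (mixedDeriv (Set.Icc a b) (Fin.cons n α) f) (Set.Icc a b) :=
    (contDiffOn_mixedDeriv hab (n := 0) (by rw [Fin.sum_cons, zero_add]) hf).continuousOn
  have hint : ∀ c : ℝ, ∀ j < n, ∀ t ∈ ({a 0, b 0} : Set ℝ),
      IntegrableOn (fun y => c * ((∏ i, (u i.succ).eval (y i)) *
        mixedDeriv (Set.Icc a b) (Fin.cons j α) f (Fin.cons t y)))
        (Set.Icc (Fin.tail a) (Fin.tail b)) := fun c j hj t ht =>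
    ((continuousOn_prod_eval_mul_mixedDeriv_cons hab _ hf hj.le
      (mem_Icc_of_mem_endpoints (hab 0).le ht)).integrableOn_compact isCompact_Icc).const_mul c
  rw [setIntegral_Icc_eq_setIntegral_cons (ContinuousOn.fun_mul (Continuous.continuousOn
    (by fun_prop)) hcont), setIntegral_congr_fun measurableSet_Icc fun y hy =>
      setIntegral_prod_eval_mul_mixedDeriv_cons hab hu hf hy]
  have hlt : ∀ j ∈ Finset.range n, n - 1 - j < n := fun j hj => by
    have := Finset.mem_range.1 hj
    omega
  have hb : b 0 ∈ ({a 0, b 0} : Set ℝ) := Set.mem_insert_of_mem _ rfl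
  have ha : a 0 ∈ ({a 0, b 0} : Set ℝ) := Set.mem_insert _ _
  rw [integral_finsetSum _ fun j hj =>
    ((hint _ _ (hlt j hj) _ hb).fun_sub (hint _ _ (hlt j hj) _ ha)).const_mul _]
  refine Finset.sum_eq_zero fun j hj => ?_
  rw [integral_const_mul, integral_sub (hint _ _ (hlt j hj) _ hb) (hint _ _ (hlt j hj) _ ha),
    integral_const_mul, integral_const_mul, hface _ (hlt j hj) _ hb, hface _ (hlt j hj) _ ha]
  simp only [mul_zero, sub_zero]

omit hab

theorem setIntegral_prod_eval_mul_mixedDeriv_eq_zero {p : ℕ} {a b : Fin p → ℝ}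
    (hab : ∀ i, a i < b i) {β : Fin p → ℕ} {u : Fin p → ℝ[X]} (hu : ∀ i, (u i).degree < β i)
    {f : (Fin p → ℝ) → ℝ}
    (hf : ContDiffOn ℝ ((∑ i, β i : ℕ) : WithTop ℕ∞) f (Set.Icc a b))
    (hv : VanishesAtVertices a b β f) :
    ∫ x in Set.Icc a b, (∏ i, (u i).eval (x i)) * mixedDeriv (Set.Icc a b) β f x = 0 := by
  induction p with
  | zero =>
    have hzero : ∀ x, mixedDeriv (Set.Icc a b) β f x = 0 := fun x =>
      hv x (fun i => i.elim0) β fun i => i.elim0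
    simp [hzero]
  | succ p ih =>
    obtain ⟨n, α, rfl⟩ : ∃ n α, β = Fin.cons n α := ⟨β 0, Fin.tail β, (Fin.cons_self_tail β).symm⟩
    rw [Fin.sum_cons] at hf
    refine setIntegral_prod_eval_mul_mixedDeriv_eq_zero_of_faces hab (hu 0) hf fun j hj t ht => ?_
    have htIcc := mem_Icc_of_mem_endpoints (hab 0).le ht
    have hle : j + ∑ i, α i ≤ n + ∑ i, α i := Nat.add_le_add_right hj.le _
    rw [← ih (fun i => hab i.succ) (fun i => hu i.succ)
      (contDiffOn_iterate_partialWithin_cons hab (hf.of_le ?_) htIcc) (hv.slice hab hf hj ht)]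
    · exact setIntegral_congr_fun measurableSet_Icc fun y hy => congrArg _
        (mixedDeriv_cons_apply_cons hab (hf.of_le (by exact_mod_cast hle)) htIcc hy)
    · simp only [Fin.cons_succ]
      rw [add_comm]
      exact_mod_cast hle

theorem setIntegral_tensorSum_mul_mixedDeriv_eq_zero {ι : Type*} {p : ℕ} {a b : Fin p → ℝ}
    (hab : ∀ i, a i < b i) {β : Fin p → ℕ} (S : Finset ι) (w : ι → ℝ) {u : ι → Fin p → ℝ[X]}
    (hu : ∀ m i, (u m i).degree < β i) {f : (Fin p → ℝ) → ℝ}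
    (hf : ContDiffOn ℝ ((∑ i, β i : ℕ) : WithTop ℕ∞) f (Set.Icc a b))
    (hv : VanishesAtVertices a b β f) :
    ∫ x in Set.Icc a b, tensorSum S w u x * mixedDeriv (Set.Icc a b) β f x = 0 := by
  have hcont : ContinuousOn (mixedDeriv (Set.Icc a b) β f) (Set.Icc a b) :=
    (contDiffOn_mixedDeriv hab (n := 0) (zero_add _).le hf).continuousOn
  have hint : ∀ m, IntegrableOn (fun x => w m * ((∏ i, (u m i).eval (x i)) *
      mixedDeriv (Set.Icc a b) β f x)) (Set.Icc a b) := fun m =>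
    ((ContinuousOn.fun_mul (Continuous.continuousOn (by fun_prop))
      hcont).integrableOn_compact isCompact_Icc).const_mul _
  simp only [tensorSum, Finset.sum_mul, mul_assoc]
  rw [integral_finsetSum _ fun m _ => hint m]
  refine Finset.sum_eq_zero fun m _ => ?_
  rw [integral_const_mul, setIntegral_prod_eval_mul_mixedDeriv_eq_zero hab (hu m) hf hv, mul_zero]

end orthogonality

/-! ### Grid cells -/

section cells

lemma exists_mem_Icc_castSucc_succ {α : Type*} [LinearOrder α] {M : ℕ} (hM : 0 < M)
    {y : Fin (M + 1) → α} {t : α} (ht : t ∈ Set.Icc (y 0) (y (Fin.last M))) :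
    ∃ c : Fin M, t ∈ Set.Icc (y c.castSucc) (y c.succ) := by
  obtain ⟨M, rfl⟩ := Nat.exists_eq_succ_of_ne_zero hM.ne'
  by_contra! h
  have hstep : ∀ c : Fin (M + 1), y c.castSucc ≤ t → y c.succ < t := fun c hc =>
    not_le.1 fun hc' => h c ⟨hc, hc'⟩
  have hle : ∀ n, y n ≤ t := Fin.induction ht.1 fun c hc => (hstep c hc).le
  exact (hstep (Fin.last M) (hle _)).not_ge ht.2

lemma exists_mem_pair_castSucc_succ {M : ℕ} (hM : 0 < M) (n : Fin (M + 1)) :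
    ∃ c : Fin M, n ∈ ({c.castSucc, c.succ} : Finset (Fin (M + 1))) := by
  obtain ⟨c, hc⟩ := exists_mem_Icc_castSucc_succ hM (y := id) (t := n)
    ⟨Fin.zero_le n, Fin.le_last n⟩
  refine ⟨c, Finset.mem_insert.2 (hc.1.eq_or_lt.imp Eq.symm fun hlt => ?_)⟩
  exact Finset.mem_singleton.2 (le_antisymm hc.2 (Fin.castSucc_lt_iff_succ_le.1 hlt))

variable {p : ℕ} (G : Grid p) (c : (i : Fin p) → Fin (G.size i))

lemma Grid.node_zero_lt_node_last (i : Fin p) : G.node i 0 < G.node i (Fin.last (G.size i)) :=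
  G.node_strictMono i (Fin.mk_lt_mk.2 (G.size_pos i))

lemma Grid.exists_mem_cell {x : Fin p → ℝ} (hx : x ∈ G.domain) : ∃ c, x ∈ G.cell c := by
  choose c hc using fun i => exists_mem_Icc_castSucc_succ (G.size_pos i) (y := G.node i)
    ⟨hx.1 i, hx.2 i⟩
  exact ⟨c, fun i => (hc i).1, fun i => (hc i).2⟩

lemma Grid.domain_eq_iUnion_cell : G.domain = ⋃ c, G.cell c :=
  Set.Subset.antisymm (fun _ hx => Set.mem_iUnion.2 (G.exists_mem_cell hx))
    (Set.iUnion_subset G.cell_subset_domain)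

lemma Grid.pairwise_aedisjoint_cell : Pairwise (Function.onFun (AEDisjoint volume) G.cell) := by
  have haux : ∀ c c' : (i : Fin p) → Fin (G.size i), ∀ i, c i < c' i →
      AEDisjoint volume (G.cell c) (G.cell c') := by
    intro c c' i hi
    refine measure_mono_null (fun x hx => ?_)
      (Measure.pi_hyperplane (fun _ : Fin p => (volume : Measure ℝ)) i (G.node i (c i).succ))
    exact le_antisymm (hx.1.2 i)
      (((G.node_strictMono i).monotone (Fin.succ_le_castSucc_iff.2 hi)).trans (hx.2.1 i))
  intro c c' h
  obtain ⟨i, hi⟩ := Function.ne_iff.1 h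
  rcases lt_or_gt_of_ne hi with h | h
  · exact haux c c' i h
  · exact (haux c' c i h).symm

lemma Grid.ae_restrict_cell_of_interior {q : (Fin p → ℝ) → Prop}
    (h : ∀ x ∈ interior (G.cell c), q x) : ∀ᵐ x ∂volume.restrict (G.cell c), q x := by
  have hnull : volume (frontier (G.cell c)) = 0 := (convex_Icc _ _).addHaar_frontier volume
  rw [← Measure.restrict_congr_set (interior_ae_eq_of_null_frontier hnull)]
  exact ae_restrict_of_forall_mem isOpen_interior.measurableSet h

lemma Grid.ae_restrict_domain_of_interior {q : (Fin p → ℝ) → Prop}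
    (h : ∀ c, ∀ x ∈ interior (G.cell c), q x) : ∀ᵐ x ∂volume.restrict G.domain, q x := by
  rw [G.domain_eq_iUnion_cell, ae_restrict_iUnion_iff]
  exact fun c => G.ae_restrict_cell_of_interior c (h c)

lemma Grid.uniqueLineDiffOn_cell : UniqueLineDiffOn (G.cell c) :=
  uniqueLineDiffOn_Icc (G.cell_lt c)

lemma Grid.vertex_mem_endpoints (q : Fin p → Fin 2) (i : Fin p) :
    G.vertex c q i ∈ ({G.node i (c i).castSucc, G.node i (c i).succ} : Set ℝ) := by
  rw [Grid.vertex]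
  split_ifs <;> simp

lemma Grid.exists_vertex_eq {v : Fin p → ℝ}
    (hv : ∀ i, v i ∈ ({G.node i (c i).castSucc, G.node i (c i).succ} : Set ℝ)) :
    ∃ q, G.vertex c q = v := by
  have hcoord : ∀ i, ∃ e : Fin 2,
      (if e = 0 then G.node i (c i).castSucc else G.node i (c i).succ) = v i := fun i => by
    rcases hv i with h | h
    exacts [⟨0, h.symm⟩, ⟨1, h.symm⟩]
  choose q hq using hcoord
  exact ⟨q, funext hq⟩

end cells

/-! ### Derivatives in the domain and in the cells -/

section derivatives

variable {p : ℕ}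

lemma hasLineDerivWithinAt_iUnion {ι E F : Type*} [Finite ι] [AddCommGroup E] [Module ℝ E]
    [TopologicalSpace E] [ContinuousAdd E] [ContinuousSMul ℝ E] [NormedAddCommGroup F]
    [NormedSpace ℝ F] {s : ι → Set E} (hs : ∀ c, IsClosed (s c)) {g : E → F} {L : F} {x v : E}
    (h : ∀ c, x ∈ s c → HasLineDerivWithinAt ℝ g L (s c) x v) :
    HasLineDerivWithinAt ℝ g L (⋃ c, s c) x v := by
  have hline : Continuous fun t : ℝ => x + t • v := by fun_prop
  have hderiv : ∀ c, HasDerivWithinAt (fun t : ℝ => g (x + t • v)) L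
      ((fun t : ℝ => x + t • v) ⁻¹' s c) 0 := by
    intro c
    by_cases hx : x ∈ s c
    · exact h c hx
    · refine HasFDerivWithinAt.of_notMem_closure ?_
      rw [((hs c).preimage hline).closure_eq]
      simpa using hx
  rw [HasLineDerivWithinAt, Set.preimage_iUnion]
  simp only [hasDerivWithinAt_iff_tendsto_slope] at hderiv ⊢
  rw [Set.iUnion_sdiff, nhdsWithin_iUnion]
  exact Filter.tendsto_iSup.2 hderiv

lemma partialWithin_eqOn_of_eq_iUnion {ι : Type*} [Finite ι] {s : ι → Set (Fin p → ℝ)}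
    (hs : ∀ c, IsClosed (s c)) {t : Set (Fin p → ℝ)} (ht : UniqueLineDiffOn t)
    (hst : t = ⋃ c, s c) {g : (Fin p → ℝ) → ℝ} {h : ι → (Fin p → ℝ) → ℝ}
    (hgh : ∀ c, Set.EqOn g (h c) (s c)) (hd : ∀ c, DifferentiableOn ℝ (h c) (s c)) {i : Fin p}
    (hjump : ∀ c c', ∀ x ∈ s c ∩ s c',
      partialWithin (s c) i (h c) x = partialWithin (s c') i (h c') x) (c : ι) :
    Set.EqOn (partialWithin t i g) (partialWithin (s c) i (h c)) (s c) := by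
  subst hst
  intro x hx
  refine HasDerivWithinAt.derivWithin (hasLineDerivWithinAt_iUnion hs fun c' hx' => ?_)
    (ht x (Set.mem_iUnion_of_mem c hx) i)
  rw [hjump c c' x ⟨hx, hx'⟩]
  exact (hd c' x hx').lineDifferentiableWithinAt.hasLineDerivWithinAt.congr (hgh c') (hgh c' hx')

lemma length_le_of_count_le {w : List (Fin p)} {k : ℕ} (hw : ∀ i, w.count i ≤ k) :
    w.length ≤ p * k := by
  calc w.length = ∑ i, w.count i := by
        simpa using (Multiset.sum_count_eq_card (s := Finset.univ) (m := (w : Multiset (Fin p)))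
          fun _ _ => Finset.mem_univ _).symm
    _ ≤ p * k := by simpa using Finset.sum_le_sum fun i (_ : i ∈ Finset.univ) => hw i

variable {G : Grid p} {k : ℕ} {N : ℕ∞} {hN : ((p * (k + 1) : ℕ) : ℕ∞) ≤ N} {φ : G.domain → ℝ}
  (hφ : φ ∈ smoothSpace G k N hN)

include hφ

lemma contDiffOn_cell (c : (i : Fin p) → Fin (G.size i)) {n : ℕ} (hn : n ≤ p * (k + 1)) :
    ContDiffOn ℝ (n : WithTop ℕ∞) (zeroExt φ) (G.cell c) := by
  refine (hφ.1 c).of_le ?_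
  have h : (n : ℕ∞) ≤ N := le_trans (by exact_mod_cast hn) hN
  exact_mod_cast h

lemma iteratedPartial_cell_eq_of_mem {w : List (Fin p)} (hw : ∀ i, w.count i ≤ k)
    (c c' : (i : Fin p) → Fin (G.size i)) {x : Fin p → ℝ} (hx : x ∈ G.cell c ∩ G.cell c') :
    iteratedPartial (G.cell c) w (zeroExt φ) x = iteratedPartial (G.cell c') w (zeroExt φ) x := by
  have hlen : w.length ≤ p * (k + 1) :=
    length_le_of_count_le fun i => (hw i).trans (Nat.le_succ k)
  have hcell := fun c => iteratedPartial_eqOn_mixedDeriv_count (G.cell_lt c) w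
    (contDiffOn_cell hφ c hlen)
  exact (hcell c hx.1).trans ((hφ.2 _ hw c c' x hx).trans (hcell c' hx.2).symm)

lemma iteratedPartial_domain_eqOn_cell {w : List (Fin p)} (hw : ∀ i, w.count i ≤ k)
    (c : (i : Fin p) → Fin (G.size i)) :
    Set.EqOn (iteratedPartial G.domain w (zeroExt φ)) (iteratedPartial (G.cell c) w (zeroExt φ))
      (G.cell c) := by
  induction w generalizing c with
  | nil => exact fun _ _ => rfl
  | cons i w ih =>
    have hlen : 1 + w.length ≤ p * (k + 1) := by
      rw [add_comm, ← List.length_cons]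
      exact length_le_of_count_le fun i => (hw i).trans (Nat.le_succ k)
    exact partialWithin_eqOn_of_eq_iUnion (fun _ => isClosed_Icc)
      (uniqueLineDiffOn_Icc G.node_zero_lt_node_last) G.domain_eq_iUnion_cell
      (ih fun j => List.count_le_count_cons.trans (hw j))
      (fun c => (contDiffOn_iteratedPartial (G.cell_lt c) w
        (contDiffOn_cell hφ c hlen)).differentiableOn one_ne_zero)
      (fun c c' x hx => iteratedPartial_cell_eq_of_mem hφ hw c c' hx) c

lemma mixedDeriv_domain_eqOn_cell {α : Fin p → ℕ} (hα : ∀ i, α i ≤ k)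
    (c : (i : Fin p) → Fin (G.size i)) :
    Set.EqOn (mixedDeriv G.domain α (zeroExt φ)) (mixedDeriv (G.cell c) α (zeroExt φ))
      (G.cell c) := by
  simp only [mixedDeriv_eq_iteratedPartial]
  exact iteratedPartial_domain_eqOn_cell hφ (fun i => (count_multiIndexWord α i).trans_le (hα i)) c

omit hφ in
lemma topDeriv_eqOn_interior_cell (φ : G.domain → ℝ) (c : (i : Fin p) → Fin (G.size i)) :
    Set.EqOn (topDeriv G k φ) (mixedDeriv (G.cell c) (fun _ => k + 1) (zeroExt φ))
      (interior (G.cell c)) := by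
  simp only [topDeriv, mixedDeriv_eq_iteratedPartial]
  exact iteratedPartial_eqOn_of_isOpen isOpen_interior
    (interior_subset.trans (G.cell_subset_domain c)) interior_subset _ fun _ _ => rfl

lemma continuousOn_mixedDeriv_cell (c : (i : Fin p) → Fin (G.size i)) :
    ContinuousOn (mixedDeriv (G.cell c) (fun _ => k + 1) (zeroExt φ)) (G.cell c) :=
  (contDiffOn_mixedDeriv (G.cell_lt c) (n := 0) (by simp)
    (contDiffOn_cell hφ c le_rfl)).continuousOn

lemma mixedDeriv_cell_add {ψ : G.domain → ℝ} (hψ : ψ ∈ smoothSpace G k N hN) {α : Fin p → ℕ}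
    (hα : ∀ i, α i ≤ k + 1) (c : (i : Fin p) → Fin (G.size i)) :
    Set.EqOn (mixedDeriv (G.cell c) α (zeroExt (φ + ψ)))
      (mixedDeriv (G.cell c) α (zeroExt φ) + mixedDeriv (G.cell c) α (zeroExt ψ)) (G.cell c) := by
  have hsum : 0 + ∑ i, α i ≤ p * (k + 1) := by
    simpa using Finset.sum_le_sum fun i (_ : i ∈ Finset.univ) => hα i
  rw [zeroExt_add]
  exact ((isDiffOp_mixedDeriv (G.cell_lt c) α).2 0 _ (contDiffOn_cell hφ c hsum)).2.2.1 _
    (contDiffOn_cell hψ c hsum)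

lemma mixedDeriv_cell_smul (r : ℝ) {α : Fin p → ℕ} (hα : ∀ i, α i ≤ k + 1)
    (c : (i : Fin p) → Fin (G.size i)) : Set.EqOn (mixedDeriv (G.cell c) α (zeroExt (r • φ)))
      (r • mixedDeriv (G.cell c) α (zeroExt φ)) (G.cell c) := by
  have hsum : 0 + ∑ i, α i ≤ p * (k + 1) := by
    simpa using Finset.sum_le_sum fun i (_ : i ∈ Finset.univ) => hα i
  rw [zeroExt_smul]
  exact ((isDiffOp_mixedDeriv (G.cell_lt c) α).2 0 _ (contDiffOn_cell hφ c hsum)).2.1 r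

end derivatives

/-! ### The interpolant -/

section interpolant

open Polynomial

variable {p : ℕ} (G : Grid p) (k : ℕ)

/-- The index set of the Hermite data of a grid: `m` stands for the derivative of order
`i ↦ (m i).2` at the node `i ↦ (m i).1`. Pairing node and order coordinate by coordinate gives the
index set the product form of the tensor product basis. -/
abbrev DataIndex : Type := (i : Fin p) → Fin (G.size i + 1) × Fin (k + 1)

variable {G k}

/-- The grid node to which a datum belongs. -/
def nodeAt (m : DataIndex G k) : Fin p → ℝ := fun i => G.node i (m i).1

/-- The node of the datum `m` is a vertex of the cell `c`. -/
def IsVertex (c : (i : Fin p) → Fin (G.size i)) (m : DataIndex G k) : Prop :=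
  ∀ i, (m i).1 ∈ ({(c i).castSucc, (c i).succ} : Finset (Fin (G.size i + 1)))

lemma exists_isVertex (m : DataIndex G k) : ∃ c, IsVertex c m :=
  Classical.skolem.1 fun i => exists_mem_pair_castSucc_succ (G.size_pos i) (m i).1

lemma IsVertex.nodeAt_mem_endpoints {c : (i : Fin p) → Fin (G.size i)} {m : DataIndex G k}
    (hm : IsVertex c m) (i : Fin p) :
    nodeAt m i ∈ ({G.node i (c i).castSucc, G.node i (c i).succ} : Set ℝ) := by
  have h := hm i
  rw [Finset.mem_insert, Finset.mem_singleton] at h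
  exact h.imp (congrArg (G.node i)) (congrArg (G.node i))

lemma IsVertex.nodeAt_mem_cell {c : (i : Fin p) → Fin (G.size i)} {m : DataIndex G k}
    (hm : IsVertex c m) : nodeAt m ∈ G.cell c :=
  ⟨fun i => (mem_Icc_of_mem_endpoints (G.cell_lt c i).le (hm.nodeAt_mem_endpoints i)).1,
    fun i => (mem_Icc_of_mem_endpoints (G.cell_lt c i).le (hm.nodeAt_mem_endpoints i)).2⟩

lemma exists_isVertex_nodeAt_eq (c : (i : Fin p) → Fin (G.size i)) {v : Fin p → ℝ}
    (hv : ∀ i, v i ∈ ({G.node i (c i).castSucc, G.node i (c i).succ} : Set ℝ))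
    {α : Fin p → ℕ} (hα : ∀ i, α i ≤ k) :
    ∃ m : DataIndex G k, IsVertex c m ∧ nodeAt m = v ∧ (fun i => ((m i).2 : ℕ)) = α := by
  have hnode : ∀ i, ∃ n ∈ ({(c i).castSucc, (c i).succ} : Finset (Fin (G.size i + 1))),
      G.node i n = v i := fun i => by
    rcases hv i with h | h
    exacts [⟨_, by simp, h.symm⟩, ⟨_, by simp, h.symm⟩]
  choose n hn hnv using hnode
  exact ⟨fun i => (n i, ⟨α i, Nat.lt_succ_of_le (hα i)⟩), hn, funext hnv, rfl⟩

/-- The polynomial in the cell `c` with the Hermite data `d` at the vertices of that cell. -/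
def cellInterpolant (d : DataIndex G k → ℝ) (c : (i : Fin p) → Fin (G.size i)) :
    (Fin p → ℝ) → ℝ :=
  tensorSum Finset.univ d fun m i => hermiteBasis (G.node_strictMono i) k (c i) (m i)

section cellInterpolant

variable (d : DataIndex G k → ℝ)

lemma mixedDeriv_cellInterpolant {s : Set (Fin p → ℝ)} (hs : UniqueLineDiffOn s)
    (c : (i : Fin p) → Fin (G.size i)) (α : Fin p → ℕ) :
    Set.EqOn (mixedDeriv s α (cellInterpolant d c)) (tensorSum Finset.univ d fun m i =>
      derivative^[α i] (hermiteBasis (G.node_strictMono i) k (c i) (m i))) s :=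
  mixedDeriv_tensorSum hs _ _ _ α

lemma tensorSum_iterate_derivative_hermiteBasis_eq_of_mem {α : Fin p → ℕ} (hα : ∀ i, α i ≤ k)
    {c c' : (i : Fin p) → Fin (G.size i)} {x : Fin p → ℝ} (hx : x ∈ G.cell c ∩ G.cell c') :
    tensorSum Finset.univ d (fun m i => derivative^[α i]
      (hermiteBasis (G.node_strictMono i) k (c i) (m i))) x =
    tensorSum Finset.univ d (fun m i => derivative^[α i]
      (hermiteBasis (G.node_strictMono i) k (c' i) (m i))) x :=
  Finset.sum_congr rfl fun m _ => congrArg _ <| Finset.prod_congr rfl fun i _ =>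
    eval_iterate_derivative_hermiteBasis_eq_of_mem (G.node_strictMono i) ⟨hx.1.1 i, hx.1.2 i⟩
      ⟨hx.2.1 i, hx.2.2 i⟩ (m i) (hα i)

lemma mixedDeriv_cellInterpolant_nodeAt {s : Set (Fin p → ℝ)} (hs : UniqueLineDiffOn s)
    {c : (i : Fin p) → Fin (G.size i)} {m : DataIndex G k} (hm : IsVertex c m)
    (hx : nodeAt m ∈ s) :
    mixedDeriv s (fun i => (m i).2) (cellInterpolant d c) (nodeAt m) = d m := by
  have hbasis : ∀ m' : DataIndex G k, ∏ i, (derivative^[(m i).2]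
      (hermiteBasis (G.node_strictMono i) k (c i) (m' i))).eval (nodeAt m i) =
        if m' = m then 1 else 0 := fun m' => by
    simp only [nodeAt, eval_iterate_derivative_hermiteBasis _ _ (hm _) (m _).2.2, Fin.eta,
      Prod.mk.eta, Finset.prod_boole, Finset.mem_univ, true_imp_iff, funext_iff]
  rw [mixedDeriv_cellInterpolant d hs c _ hx]
  simp only [tensorSum, hbasis, mul_ite, mul_one, mul_zero, Finset.sum_ite_eq', Finset.mem_univ,
    if_true]

lemma cellInterpolant_congr {d d' : DataIndex G k → ℝ} {c : (i : Fin p) → Fin (G.size i)}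
    (h : ∀ m, IsVertex c m → d m = d' m) : cellInterpolant d c = cellInterpolant d' c := by
  funext x
  refine Finset.sum_congr rfl fun m _ => ?_
  by_cases hm : IsVertex c m
  · rw [h m hm]
  · obtain ⟨i, hi⟩ := not_forall.1 hm
    have hzero : ∏ i, (hermiteBasis (G.node_strictMono i) k (c i) (m i)).eval (x i) = 0 :=
      Finset.prod_eq_zero (Finset.mem_univ i) <| by rw [hermiteBasis_eq_zero _ hi, eval_zero]
    rw [hzero, mul_zero, mul_zero]

lemma cellInterpolant_tensorSum {ι : Type*} (S : Finset ι) (w : ι → ℝ) {u : ι → Fin p → ℝ[X]}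
    (hu : ∀ e ∈ S, ∀ i, (u e i).natDegree ≤ 2 * k + 1) (c : (i : Fin p) → Fin (G.size i)) :
    cellInterpolant (fun m : DataIndex G k =>
      tensorSum S w (fun e i => derivative^[(m i).2] (u e i)) (nodeAt m)) c =
        tensorSum S w u := by
  funext x
  have hfactor : ∀ e ∈ S, ∏ i, (u e i).eval (x i) = ∑ m : DataIndex G k,
      (∏ i, (derivative^[(m i).2] (u e i)).eval (nodeAt m i)) *
        ∏ i, (hermiteBasis (G.node_strictMono i) k (c i) (m i)).eval (x i) := by
    intro e he
    have heval : ∀ i, (u e i).eval (x i) = ∑ m : Fin (G.size i + 1) × Fin (k + 1),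
        (derivative^[m.2] (u e i)).eval (G.node i m.1) *
          (hermiteBasis (G.node_strictMono i) k (c i) m).eval (x i) := fun i => by
      simpa only [eval_finsetSum, eval_mul, eval_C] using congrArg (eval (x i))
        (sum_eval_iterate_derivative_mul_hermiteBasis (G.node_strictMono i) (c i) (hu e he i)).symm
    rw [Finset.prod_congr rfl fun i _ => heval i, Finset.prod_univ_sum, Fintype.piFinset_univ]
    exact Finset.sum_congr rfl fun m _ => Finset.prod_mul_distrib
  simp only [cellInterpolant, tensorSum, Finset.sum_mul]
  rw [Finset.sum_comm]
  refine Finset.sum_congr rfl fun e he => ?_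
  rw [hfactor e he, Finset.mul_sum]
  exact Finset.sum_congr rfl fun m _ => mul_assoc _ _ _

lemma cellInterpolant_mixedDeriv_eval {Q : MvPolynomial (Fin p) ℝ}
    (hQ : ∀ i, Q.degreeOf i ≤ 2 * k + 1) (c : (i : Fin p) → Fin (G.size i)) :
    cellInterpolant (fun m : DataIndex G k =>
      mixedDeriv Set.univ (fun i => (m i).2) (fun x => MvPolynomial.eval x Q) (nodeAt m)) c =
        fun x => MvPolynomial.eval x Q := by
  have hdeg : ∀ e ∈ Q.support, ∀ i, (X ^ e i : ℝ[X]).natDegree ≤ 2 * k + 1 := fun e he i => by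
    rw [natDegree_X_pow]
    exact (MvPolynomial.degreeOf_le_iff.1 le_rfl e he).trans (hQ i)
  simp only [eval_eq_tensorSum,
    mixedDeriv_tensorSum uniqueLineDiffOn_univ _ _ _ _ (Set.mem_univ _)]
  exact cellInterpolant_tensorSum _ _ hdeg c

end cellInterpolant

/-- The piecewise polynomial with the Hermite data `d`. The choice of the cell containing a point
is immaterial by `interpolant_eq_cellInterpolant`. -/
def interpolant (d : DataIndex G k → ℝ) : G.domain → ℝ := fun x =>
  cellInterpolant d (G.exists_mem_cell x.2).choose x

lemma interpolant_eq_cellInterpolant (d : DataIndex G k → ℝ) {c : (i : Fin p) → Fin (G.size i)}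
    {x : G.domain} (hx : (x : Fin p → ℝ) ∈ G.cell c) :
    interpolant d x = cellInterpolant d c x :=
  tensorSum_iterate_derivative_hermiteBasis_eq_of_mem d (α := 0) (fun _ => Nat.zero_le k)
    ⟨(G.exists_mem_cell x.2).choose_spec, hx⟩

lemma zeroExt_interpolant_eqOn_cell (d : DataIndex G k → ℝ) (c : (i : Fin p) → Fin (G.size i)) :
    Set.EqOn (zeroExt (interpolant d)) (cellInterpolant d c) (G.cell c) := fun x hx =>
  (Subtype.val_injective.extend_apply _ _ ⟨x, G.cell_subset_domain c hx⟩).trans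
    (interpolant_eq_cellInterpolant d hx)

lemma mixedDeriv_interpolant_eqOn_cell (d : DataIndex G k → ℝ)
    (c : (i : Fin p) → Fin (G.size i)) (α : Fin p → ℕ) :
    Set.EqOn (mixedDeriv (G.cell c) α (zeroExt (interpolant d)))
      (mixedDeriv (G.cell c) α (cellInterpolant d c)) (G.cell c) := by
  simp only [mixedDeriv_eq_iteratedPartial]
  exact iteratedPartial_congr _ (zeroExt_interpolant_eqOn_cell d c)

variable (N : ℕ∞) (hN : ((p * (k + 1) : ℕ) : ℕ∞) ≤ N)

lemma interpolant_mem_smoothSpace (d : DataIndex G k → ℝ) :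
    interpolant d ∈ smoothSpace G k N hN := by
  refine ⟨fun c => ?_, fun α hα c c' x hx => ?_⟩
  · exact (contDiff_tensorSum _ _ _).contDiffOn.congr (zeroExt_interpolant_eqOn_cell d c)
  · rw [mixedDeriv_interpolant_eqOn_cell d c α hx.1, mixedDeriv_interpolant_eqOn_cell d c' α hx.2,
      mixedDeriv_cellInterpolant d (G.uniqueLineDiffOn_cell c) c α hx.1,
      mixedDeriv_cellInterpolant d (G.uniqueLineDiffOn_cell c') c' α hx.2]
    exact tensorSum_iterate_derivative_hermiteBasis_eq_of_mem d hα hx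

/-- The interpolant as a linear function of its Hermite data. -/
def interpolantMap : (DataIndex G k → ℝ) →ₗ[ℝ] smoothSpace G k N hN where
  toFun d := ⟨interpolant d, interpolant_mem_smoothSpace N hN d⟩
  map_add' d d' := Subtype.ext <| funext fun x => by
    simp [interpolant, cellInterpolant, tensorSum, add_mul, Finset.sum_add_distrib]
  map_smul' r d := Subtype.ext <| funext fun x => by
    simp [interpolant, cellInterpolant, tensorSum, Finset.mul_sum, mul_assoc]

/-- The derivatives of a function that its Hermite interpolant has to match. -/
def hermiteData (φ : G.domain → ℝ) (m : DataIndex G k) : ℝ :=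
  mixedDeriv G.domain (fun i => (m i).2) (zeroExt φ) (nodeAt m)

variable {N hN}

lemma hermiteData_eq_mixedDeriv_cell {φ : G.domain → ℝ} (hφ : φ ∈ smoothSpace G k N hN)
    {m : DataIndex G k} {c : (i : Fin p) → Fin (G.size i)} (hm : IsVertex c m) :
    hermiteData φ m = mixedDeriv (G.cell c) (fun i => (m i).2) (zeroExt φ) (nodeAt m) :=
  mixedDeriv_domain_eqOn_cell hφ (fun i => Nat.le_of_lt_succ (m i).2.2) c hm.nodeAt_mem_cell

variable (G k N hN) in
/-- The Hermite data as a linear function of `φ` in the space of piecewise smooth functions. -/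
def hermiteDataMap : smoothSpace G k N hN →ₗ[ℝ] (DataIndex G k → ℝ) where
  toFun φ := hermiteData φ
  map_add' f g := by
    funext m
    obtain ⟨c, hc⟩ := exists_isVertex m
    rw [Pi.add_apply, hermiteData_eq_mixedDeriv_cell (f + g).2 hc,
      hermiteData_eq_mixedDeriv_cell f.2 hc, hermiteData_eq_mixedDeriv_cell g.2 hc]
    exact mixedDeriv_cell_add f.2 g.2 (fun i => (m i).2.2.le) c hc.nodeAt_mem_cell
  map_smul' r f := by
    funext m
    obtain ⟨c, hc⟩ := exists_isVertex m
    rw [Pi.smul_apply, hermiteData_eq_mixedDeriv_cell (r • f).2 hc,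
      hermiteData_eq_mixedDeriv_cell f.2 hc]
    exact mixedDeriv_cell_smul f.2 r (fun i => (m i).2.2.le) c hc.nodeAt_mem_cell

lemma hermiteDataMap_interpolantMap (d : DataIndex G k → ℝ) :
    hermiteDataMap G k N hN (interpolantMap N hN d) = d := by
  funext m
  obtain ⟨c, hc⟩ := exists_isVertex m
  refine (hermiteData_eq_mixedDeriv_cell (interpolant_mem_smoothSpace N hN d) hc).trans ?_
  rw [mixedDeriv_interpolant_eqOn_cell d c _ hc.nodeAt_mem_cell]
  exact mixedDeriv_cellInterpolant_nodeAt d (G.uniqueLineDiffOn_cell c) hc hc.nodeAt_mem_cell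

variable (G k N hN) in
/-- The projection `φ ↦ H_φ`. -/
def hermiteProj : smoothSpace G k N hN →ₗ[ℝ] smoothSpace G k N hN :=
  interpolantMap N hN ∘ₗ hermiteDataMap G k N hN

lemma hermiteDataMap_hermiteProj (f : smoothSpace G k N hN) :
    hermiteDataMap G k N hN (hermiteProj G k N hN f) = hermiteDataMap G k N hN f :=
  hermiteDataMap_interpolantMap _

lemma isIdempotentElem_hermiteProj : IsIdempotentElem (hermiteProj G k N hN) :=
  LinearMap.ext fun f => congrArg (interpolantMap N hN) (hermiteDataMap_hermiteProj f)

lemma isHermiteInterpolant_interpolant (φ : G.domain → ℝ) :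
    IsHermiteInterpolant G k φ (interpolant (hermiteData (k := k) φ)) := by
  intro c
  obtain ⟨Q, hdeg, heval⟩ := exists_mvPolynomial_eval_eq_tensorSum Finset.univ
    (hermiteData (G := G) (k := k) φ) fun m i =>
      natDegree_hermiteBasis_le (G.node_strictMono i) (c i) (m i)
  refine ⟨Q, hdeg, fun x hx => (interpolant_eq_cellInterpolant _ hx).trans (heval x).symm,
    fun q α hα => ?_⟩
  obtain ⟨m, hm, hq, rfl⟩ := exists_isVertex_nodeAt_eq c (G.vertex_mem_endpoints c q) hα
  rw [← hq, funext heval]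
  exact mixedDeriv_cellInterpolant_nodeAt _ uniqueLineDiffOn_univ hm (Set.mem_univ _)

lemma isHermiteInterpolant_iff (φ H : G.domain → ℝ) :
    IsHermiteInterpolant G k φ H ↔ H = interpolant (hermiteData (k := k) φ) := by
  refine ⟨fun h => funext fun x => ?_, fun h => h ▸ isHermiteInterpolant_interpolant φ⟩
  obtain ⟨c, hx⟩ := G.exists_mem_cell x.2
  obtain ⟨Q, hdeg, heval, hdata⟩ := h c
  rw [heval x hx, interpolant_eq_cellInterpolant _ hx,
    ← congrFun (cellInterpolant_mixedDeriv_eval hdeg c) (x : Fin p → ℝ)]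
  refine congrFun (cellInterpolant_congr fun m hm => ?_) _
  obtain ⟨q, hq⟩ := G.exists_vertex_eq c hm.nodeAt_mem_endpoints
  rw [hermiteData, ← hq]
  exact hdata q _ fun i => Nat.le_of_lt_succ (m i).2.2

end interpolant

/-! ### The bilinear form -/

section bilinear

open Polynomial

variable {p : ℕ} {G : Grid p} {k : ℕ} {N : ℕ∞} {hN : ((p * (k + 1) : ℕ) : ℕ∞) ≤ N}

lemma topDeriv_add_ae {f g : G.domain → ℝ} (hf : f ∈ smoothSpace G k N hN)
    (hg : g ∈ smoothSpace G k N hN) : ∀ᵐ x ∂volume.restrict G.domain,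
      topDeriv G k (f + g) x = topDeriv G k f x + topDeriv G k g x := by
  refine G.ae_restrict_domain_of_interior fun c x hx => ?_
  simp only [topDeriv_eqOn_interior_cell _ c hx]
  exact mixedDeriv_cell_add hf hg (fun _ => le_rfl) c (interior_subset hx)

lemma topDeriv_smul_ae {f : G.domain → ℝ} (hf : f ∈ smoothSpace G k N hN) (r : ℝ) :
    ∀ᵐ x ∂volume.restrict G.domain, topDeriv G k (r • f) x = r * topDeriv G k f x := by
  refine G.ae_restrict_domain_of_interior fun c x hx => ?_
  simp only [topDeriv_eqOn_interior_cell _ c hx]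
  exact mixedDeriv_cell_smul hf r (fun _ => le_rfl) c (interior_subset hx)

lemma integrableOn_topDeriv_mul {f g : G.domain → ℝ} (hf : f ∈ smoothSpace G k N hN)
    (hg : g ∈ smoothSpace G k N hN) :
    IntegrableOn (fun x => topDeriv G k f x * topDeriv G k g x) G.domain := by
  rw [G.domain_eq_iUnion_cell, integrableOn_finite_iUnion]
  intro c
  have hcell := ((continuousOn_mixedDeriv_cell hf c).mul
    (continuousOn_mixedDeriv_cell hg c)).integrableOn_compact (μ := volume) isCompact_Icc
  refine Integrable.congr hcell (G.ae_restrict_cell_of_interior c fun x hx => ?_)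
  simp only [topDeriv_eqOn_interior_cell _ c hx, Pi.mul_apply]

variable (G k N hN) in
/-- The bilinear form `B(f, g) = ∫_Ω ∂^β f ∂^β g` whose quadratic form is the stability
functional. -/
def stabilityForm : LinearMap.BilinForm ℝ (smoothSpace G k N hN) :=
  LinearMap.mk₂ ℝ (fun f g => ∫ x in G.domain, topDeriv G k f x * topDeriv G k g x)
    (fun f f' g => by
      rw [← integral_add (integrableOn_topDeriv_mul f.2 g.2) (integrableOn_topDeriv_mul f'.2 g.2)]
      refine integral_congr_ae ((topDeriv_add_ae f.2 f'.2).mono fun x hx => ?_)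
      simp only [Submodule.coe_add, hx, add_mul])
    (fun r f g => by
      rw [smul_eq_mul, ← integral_const_mul]
      refine integral_congr_ae ((topDeriv_smul_ae f.2 r).mono fun x hx => ?_)
      simp only [Submodule.coe_smul, hx, mul_assoc])
    (fun f g g' => by
      rw [← integral_add (integrableOn_topDeriv_mul f.2 g.2) (integrableOn_topDeriv_mul f.2 g'.2)]
      refine integral_congr_ae ((topDeriv_add_ae g.2 g'.2).mono fun x hx => ?_)
      simp only [Submodule.coe_add, hx, mul_add])
    (fun r f g => by
      rw [smul_eq_mul, ← integral_const_mul]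
      refine integral_congr_ae ((topDeriv_smul_ae g.2 r).mono fun x hx => ?_)
      simp only [Submodule.coe_smul, hx, mul_left_comm])

lemma stabilityForm_apply (f g : smoothSpace G k N hN) : stabilityForm G k N hN f g =
    ∫ x in G.domain, topDeriv G k f x * topDeriv G k g x := rfl

lemma stabilityForm_self (f : smoothSpace G k N hN) :
    stabilityForm G k N hN f f = stabilityFunctional G k f := by
  simp only [stabilityForm_apply, stabilityFunctional, sq]

lemma isPosSemidef_stabilityForm : (stabilityForm G k N hN).IsPosSemidef where
  eq f g := by
    simp only [stabilityForm_apply, mul_comm]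
  nonneg f := by
    rw [stabilityForm_apply]
    exact integral_nonneg fun x => mul_self_nonneg _

lemma vanishesAtVertices_of_hermiteDataMap_eq_zero {w : smoothSpace G k N hN}
    (hw : hermiteDataMap G k N hN w = 0) (c : (i : Fin p) → Fin (G.size i)) :
    VanishesAtVertices (fun i => G.node i (c i).castSucc) (fun i => G.node i (c i).succ)
      (fun _ => k + 1) (zeroExt (w : G.domain → ℝ)) := by
  intro v hv α hα
  obtain ⟨m, hm, rfl, rfl⟩ := exists_isVertex_nodeAt_eq c hv fun i => Nat.le_of_lt_succ (hα i)
  exact (hermiteData_eq_mixedDeriv_cell w.2 hm).symm.trans (congrFun hw m)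

lemma setIntegral_cell_topDeriv_interpolant_mul_eq_zero (d : DataIndex G k → ℝ)
    {w : smoothSpace G k N hN} (hw : hermiteDataMap G k N hN w = 0)
    (c : (i : Fin p) → Fin (G.size i)) :
    ∫ x in G.cell c, topDeriv G k (interpolant d) x * topDeriv G k w x = 0 := by
  have hdeg : ∀ (m : DataIndex G k) i, (derivative^[k + 1]
      (hermiteBasis (G.node_strictMono i) k (c i) (m i))).degree < (k + 1 : ℕ) := fun m i => by
    have hle := natDegree_hermiteBasis_le (G.node_strictMono i) (c i) (m i)
    exact degree_lt_add_one_iff.2 ((natDegree_iterate_derivative _ _).trans (by omega))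
  rw [← setIntegral_tensorSum_mul_mixedDeriv_eq_zero (G.cell_lt c) Finset.univ d hdeg
    (contDiffOn_cell w.2 c (by simp)) (vanishesAtVertices_of_hermiteDataMap_eq_zero hw c)]
  refine integral_congr_ae (G.ae_restrict_cell_of_interior c fun x hx => ?_)
  simp only [topDeriv_eqOn_interior_cell _ c hx,
    mixedDeriv_interpolant_eqOn_cell d c _ (interior_subset hx),
    mixedDeriv_cellInterpolant d (G.uniqueLineDiffOn_cell c) c _ (interior_subset hx)]
  rfl

lemma stabilityForm_interpolantMap_eq_zero (d : DataIndex G k → ℝ) {w : smoothSpace G k N hN}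
    (hw : hermiteDataMap G k N hN w = 0) :
    stabilityForm G k N hN (interpolantMap N hN d) w = 0 := by
  have hint := integrableOn_topDeriv_mul (interpolant_mem_smoothSpace N hN d) w.2
  have hsum := integral_iUnion_ae (fun c => (measurableSet_Icc.nullMeasurableSet :
    NullMeasurableSet (G.cell c))) G.pairwise_aedisjoint_cell
    (hint.mono_set G.domain_eq_iUnion_cell.ge)
  simp only [setIntegral_cell_topDeriv_interpolant_mul_eq_zero d hw, tsum_zero] at hsum
  rwa [← G.domain_eq_iUnion_cell] at hsum

end bilinear

end HermiteProj

end

open HermiteProj in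
theorem mainTheorem4 (p k : ℕ) (N : ℕ∞) (hN : ((p * (k + 1) : ℕ) : ℕ∞) ≤ N) (G : Grid p) :
    ∃ (B : LinearMap.BilinForm ℝ (smoothSpace G k N hN))
      (P : smoothSpace G k N hN →ₗ[ℝ] smoothSpace G k N hN),
      (∀ f g : smoothSpace G k N hN,
        MeasureTheory.IntegrableOn (fun x => topDeriv G k f x * topDeriv G k g x) G.domain ∧
        B f g = ∫ x in G.domain, topDeriv G k f x * topDeriv G k g x) ∧
      (∀ f : smoothSpace G k N hN, B f f = stabilityFunctional G k f) ∧
      B.IsPosSemidef ∧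
      (∀ (φ : smoothSpace G k N hN) (H : G.domain → ℝ),
        IsHermiteInterpolant G k φ H ↔ H = P φ) ∧
      IsIdempotentElem P ∧
      (∀ u ∈ LinearMap.range P, ∀ v ∈ LinearMap.ker P, B u v = 0) ∧
      (∀ (f g : smoothSpace G k N hN) (c : (i : Fin p) → Fin (G.size i)),
        ∫ x in G.cell c, topDeriv G k (P f) x * topDeriv G k (g - P g : smoothSpace G k N hN) x
          = 0) := by
  refine ⟨stabilityForm G k N hN, hermiteProj G k N hN,
    fun f g => ⟨integrableOn_topDeriv_mul f.2 g.2, rfl⟩, stabilityForm_self,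
    isPosSemidef_stabilityForm, fun φ H => isHermiteInterpolant_iff _ H,
    isIdempotentElem_hermiteProj, ?_, fun f g c => ?_⟩
  · rintro _ ⟨f, rfl⟩ v hv
    refine stabilityForm_interpolantMap_eq_zero _ ?_
    rw [← hermiteDataMap_hermiteProj, LinearMap.mem_ker.1 hv, map_zero]
  · refine setIntegral_cell_topDeriv_interpolant_mul_eq_zero (hermiteDataMap G k N hN f) ?_ c
    rw [map_sub, hermiteDataMap_hermiteProj, sub_self]
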